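/- \textbf{Setting.} For $k\in\{1,2\}$ phase $k$ has a complete equation of state: a pressure $p_k(\rho,e)$, a temperature $T_k(\rho,e)>0$ and an entropy $s_k(\rho,e)$, defined for $\rho,e>0$, with $ds_k=\frac1{T_k}\left(\frac{p_k}{\rho^2}d\rho-de\right)$. Let $e_k(\tau,s)$ be the inverse of $e\mapsto s_k(1/\tau,e)$ and $\mathcal P_k(\tau,s)=p_k(1/\tau,e_k(\tau,s))$. Let $a_1,a_2>0$. A state $W$ consists of $\alpha_1$, $\alpha_2=1-\alpha_1$, and $\rho_k,u_k,s_k,\mathcal T_k$; put $\tau_k=1/\rho_k$, $$\pi_k=\mathcal P_k(\mathcal T_k,s_k)+a_k^2(\mathcal T_k-\tau_k),\qquad \mathcal E_k=\frac{u_k^2}2+e_k(\mathcal T_k,s_k)+\frac{\pi_k^2-\mathcal P_k(\mathcal T_k,s_k)^2}{2a_k^2}.$$ The state is admissible if $0<\alpha_1<1$, $\rho_k>0$, $\mathcal T_k>0$ and $(\mathcal T_k,s_k)$ is in the domain of the equation of state ($s_k=s_k(1/\mathcal T_k,e)$ for some $e>0$), $k=1,2$. \textbf{Solutions.} Let $W_L,W_R$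 be admissible. A \emph{solution with subsonic wave ordering} of the relaxation Riemann problem, with interface velocity $u_2^*$, interface pressure $\pi_1^*$ and dissipation $\mathcal Q\ge0$, is a self-similar function $W(x/t)$ such that: (i) $W(\xi)$ is admissible for all $\xi$; it is piecewise constant, constant away from at most six speeds, one for each of the eigenvalues $u_k-a_k\tau_k,\ u_k,\ u_k+a_k\tau_k$ ($k=1,2$); each of these eigenvalues equals its speed on both sides of it, and the speed of the eigenvalue $u_2$ is $u_2^*$; $W(\xi)=W_L$ if $\xi<\min_k(u_{k,L}-a_k\tau_{k,L})$ and $W(\xi)=W_R$ if $\xi>\max_k(u_{k,R}+a_k\tau_{k,R})$; (ii) for $k=1,2$, in the sense of distributions on $\mathbb R\times(0,\infty)$, $$\partial_t\alpha_k+u_2^*\partial_x\alpha_k=0,\quad \partial_x\alpha_k=(\alpha_{k,R}-\alpha_{k,L})\,\delta_{x-u_2^*t},\quad \partial_t(\alpha_k\rho_k)+\partial_x(\alpha_k\rho_ku_k)=0,$$ $$\partial_t(\alpha_k\rho_ku_k)+\partial_x(\alpha_k\rho_ku_k^2+\alpha_k\pi_k)-\pi_1^*\partial_x\alpha_k=0,$$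 $$\partial_t(\alpha_k\rho_ks_k)+\partial_x(\alpha_k\rho_ks_ku_k)=0,\quad \partial_t(\alpha_k\rho_k\mathcal T_k)+\partial_x(\alpha_k\rho_k\mathcal T_ku_k)=0;$$ (iii) in the sense of distributions $$\partial_t(\alpha_k\rho_k\mathcal E_k)+\partial_x(\alpha_k\rho_k\mathcal E_ku_k+\alpha_k\pi_ku_k)-u_2^*\pi_1^*\partial_x\alpha_k=-\mathcal Q_k\,\delta_{x-u_2^*t},\qquad \mathcal Q_1=\mathcal Q\ge0,\ \mathcal Q_2=0;$$ (iv) $u_{1,L}-a_1\tau_{1,L}<u_2^*<u_{1,R}+a_1\tau_{1,R}$. \textbf{Notation on the data.} $$u_k^\sharp=\tfrac12(u_{k,L}+u_{k,R})-\tfrac1{2a_k}(\pi_{k,R}-\pi_{k,L}),\qquad \pi_k^\sharp=\tfrac12(\pi_{k,R}+\pi_{k,L})-\tfrac{a_k}2(u_{k,R}-u_{k,L}),$$ $$\tau^\sharp_{k,L}=\tau_{k,L}+\tfrac1{a_k}(u_k^\sharp-u_{k,L}),\qquad \tau^\sharp_{k,R}=\tau_{k,R}-\tfrac1{a_k}(u_k^\sharp-u_{k,R}),\qquad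 \Lambda^\alpha=\frac{\alpha_{2,R}-\alpha_{2,L}}{\alpha_{2,R}+\alpha_{2,L}}.$$ A \emph{coupled phase $1$ solution} is a quadruple $(u_2^*,\pi_1^*,\mathcal Q,v)$, where $v(x/t)=(\rho_1,u_1,s_1,\mathcal T_1)(x/t)$, such that, with $\alpha_1(\xi)=\alpha_{1,L}$ for $\xi<u_2^*$ and $\alpha_1(\xi)=\alpha_{1,R}$ for $\xi\ge u_2^*$, phase $1$ satisfies its part of (i)--(iv): admissible values; constant away from $u_2^*$ and three speeds, on both sides of which the eigenvalues $u_1-a_1\tau_1$, $u_1$, $u_1+a_1\tau_1$ respectively equal their speeds; phase $1$ of $W_L$ for $\xi<u_{1,L}-a_1\tau_{1,L}$ and of $W_R$ for $\xi>u_{1,R}+a_1\tau_{1,R}$; the phase $1$ mass, momentum, entropy, $\mathcal T_1$ and energy equations with $\mathcal Q\ge0$; (iv); and such that $\pi_1^*$ is the interface pressure exerted by phase $2$: $$(\alpha_{1,R}-\alpha_{1,L})\,\pi_1^*=(\alpha_{1,R}-\alpha_{1,L})\,\pi_2^\sharp-a_2(\alpha_{2,R}+\alpha_{2,L})(u_2^*-u_2^\sharp).$$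 \textbf{Theorem.} Let $W_L,W_R$ be admissible, let $a_1,a_2>0$ be such that $\tau^\sharp_{k,L}>0$ and $\tau^\sharp_{k,R}>0$ for $k=1,2$, and assume $$(\mathbf A)\qquad -a_1\tau^\sharp_{1,R}<\frac{u_1^\sharp-u_2^\sharp-\frac1{a_2}\Lambda^\alpha(\pi_1^\sharp-\pi_2^\sharp)}{1+\frac{a_1}{a_2}|\Lambda^\alpha|}<a_1\tau^\sharp_{1,L}.$$ Then there exists a coupled phase $1$ solution (in particular with positive phase $1$ densities). Moreover, for every coupled phase $1$ solution $(u_2^*,\pi_1^*,\mathcal Q,v)$ whose velocity $u_2^*$ satisfies the positivity condition for the phase $2$ densities $$(\mathbf B)\qquad u_2^\sharp-a_2\tau^\sharp_{2,L}<u_2^*<u_2^\sharp+a_2\tau^\sharp_{2,R},$$ there exists a solution with subsonic wave ordering of the relaxation Riemann problem with data $W_L,W_R$, with this $u_2^*$, this $\pi_1^*$, this $\mathcal Q$, and phase $1$ part $v$. -/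

import Mathlib

open Filter Topology MeasureTheory Set
open scoped ContDiff

noncomputable section

namespace BaerNunziato

/-! ### Thermodynamics

Phase `1` of the model has index `0 : Fin 2`, phase `2` has index `1 : Fin 2`. -/

/-- A complete equation of state: pressure `p`, temperature `temp` and (mathematical) entropy
`entropy`, as functions of the density and of the specific internal energy (both positive),
subject to the second principle `d s = (1/T) (p/ρ² dρ - de)` with a positive integrating factor
`T`.  No convexity of the entropy is required. -/
structure EOS where
  p : ℝ → ℝ → ℝ
  temp : ℝ → ℝ → ℝ
  entropy : ℝ → ℝ → ℝ
  temp_pos : ∀ ρ e : ℝ, 0 < ρ → 0 < e → 0 < temp ρ e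
  second_law : ∀ ρ e : ℝ, 0 < ρ → 0 < e →
    HasFDerivAt (fun z : ℝ × ℝ => entropy z.1 z.2)
      ((temp ρ e)⁻¹ • ((p ρ e / ρ ^ 2) • ContinuousLinearMap.fst ℝ ℝ ℝ
        - ContinuousLinearMap.snd ℝ ℝ ℝ)) (ρ, e)

namespace EOS

/-- `(τ, s)` is a thermodynamic state: `s` is the entropy of some positive internal energy at the
specific volume `τ`. -/
def InDomain (E : EOS) (τ s : ℝ) : Prop :=
  0 < τ ∧ ∃ e : ℝ, 0 < e ∧ E.entropy τ⁻¹ e = s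

/-- The internal energy `e(τ, s)`: the inverse of the (strictly decreasing) map
`e ↦ s(1/τ, e)` on the positive energies. -/
def energy (E : EOS) (τ s : ℝ) : ℝ :=
  Function.invFunOn (fun e => E.entropy τ⁻¹ e) (Ioi 0) s

/-- The pressure `𝒫(τ, s) = p(1/τ, e(τ, s))`. -/
def pressure (E : EOS) (τ s : ℝ) : ℝ :=
  E.p τ⁻¹ (E.energy τ s)

end EOS

/-! ### States of the relaxation system -/

/-- The unknowns of one phase: density `ρ`, velocity `u`, specific entropy `s` and the additional
relaxation unknown `𝒯` (here `rel`). -/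
structure PhaseState where
  ρ : ℝ
  u : ℝ
  s : ℝ
  rel : ℝ

namespace PhaseState

/-- Specific volume `τ = 1/ρ`. -/
def τ (v : PhaseState) : ℝ := v.ρ⁻¹

/-- Linearized pressure `π = 𝒫(𝒯, s) + a² (𝒯 - τ)`. -/
def relPressure (E : EOS) (a : ℝ) (v : PhaseState) : ℝ :=
  E.pressure v.rel v.s + a ^ 2 * (v.rel - v.τ)

/-- Relaxation total energy `ℰ = u²/2 + e(𝒯, s) + (π² - 𝒫(𝒯, s)²) / (2a²)`. -/
def relEnergy (E : EOS) (a : ℝ) (v : PhaseState) : ℝ :=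
  v.u ^ 2 / 2 + E.energy v.rel v.s
    + (v.relPressure E a ^ 2 - E.pressure v.rel v.s ^ 2) / (2 * a ^ 2)

/-- Positive density, positive `𝒯`, and `(𝒯, s)` in the domain of the equation of state. -/
def Admissible (E : EOS) (v : PhaseState) : Prop :=
  0 < v.ρ ∧ 0 < v.rel ∧ E.InDomain v.rel v.s

/-- The eigenvalues `u - aτ`, `u`, `u + aτ` attached to one phase. -/
def eigenvalue (a : ℝ) (j : Fin 3) (v : PhaseState) : ℝ :=
  ![v.u - a * v.τ, v.u, v.u + a * v.τ] j

end PhaseState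

/-- A state of the relaxation system, recorded by the fraction `α₁` and the phasic unknowns.  On
the admissible set this is equivalent to the vector
`(α₁, α_k ρ_k, α_k ρ_k u_k, α_k ρ_k s_k, α_k ρ_k 𝒯_k)`. -/
structure State where
  α₁ : ℝ
  phase : Fin 2 → PhaseState

namespace State

/-- The phase fractions `α₁` and `α₂ = 1 - α₁`. -/
def frac (W : State) (k : Fin 2) : ℝ := ![W.α₁, 1 - W.α₁] k

/-- The admissible set `Ω_W`. -/
def Admissible (E : Fin 2 → EOS) (W : State) : Prop :=
  0 < W.α₁ ∧ W.α₁ < 1 ∧ ∀ k, (W.phase k).Admissible (E k)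

end State

/-! ### Distributions on `{(x, t) : t > 0}` attached to self-similar functions `f(x/t)` -/

/-- Test functions: smooth with compact support in `ℝ × (0, ∞)`; points are `(x, t)`. -/
def IsTest (φ : ℝ × ℝ → ℝ) : Prop :=
  ContDiff ℝ ∞ φ ∧ HasCompactSupport φ ∧ tsupport φ ⊆ {z | 0 < z.2}

/-- `⟨∂ₜ (f(x/t)), φ⟩`. -/
def distDt (f : ℝ → ℝ) (φ : ℝ × ℝ → ℝ) : ℝ :=
  -∫ z : ℝ × ℝ, f (z.1 / z.2) * fderiv ℝ φ z (0, 1)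

/-- `⟨∂ₓ (f(x/t)), φ⟩`. -/
def distDx (f : ℝ → ℝ) (φ : ℝ × ℝ → ℝ) : ℝ :=
  -∫ z : ℝ × ℝ, f (z.1 / z.2) * fderiv ℝ φ z (1, 0)

/-- `⟨δ_{x - ct}, φ⟩`. -/
def dirac (c : ℝ) (φ : ℝ × ℝ → ℝ) : ℝ :=
  ∫ t in Ioi (0 : ℝ), φ (c * t, t)

/-- The balance equations of one phase, in the sense of distributions, for the self-similar fields
`α(x/t)`, `v(x/t)`, with interface velocity `u₂`, interface pressure `π₁` and dissipation `Q`: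
* mass `∂ₜ(αρ) + ∂ₓ(αρu) = 0`;
* momentum `∂ₜ(αρu) + ∂ₓ(αρu² + απ) - π₁ ∂ₓα = 0`;
* entropy `∂ₜ(αρs) + ∂ₓ(αρsu) = 0`;
* relaxation unknown `∂ₜ(αρ𝒯) + ∂ₓ(αρ𝒯u) = 0`;
* energy `∂ₜ(αρℰ) + ∂ₓ(αρℰu + απu) - u₂ π₁ ∂ₓα = -Q δ_{x - u₂t}`. -/
structure PhaseEquations (E : EOS) (a u₂ π₁ Q : ℝ) (α : ℝ → ℝ) (v : ℝ → PhaseState) :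
    Prop where
  mass : ∀ φ, IsTest φ →
    distDt (fun ξ => α ξ * (v ξ).ρ) φ + distDx (fun ξ => α ξ * (v ξ).ρ * (v ξ).u) φ = 0
  momentum : ∀ φ, IsTest φ →
    distDt (fun ξ => α ξ * (v ξ).ρ * (v ξ).u) φ
      + distDx (fun ξ => α ξ * (v ξ).ρ * (v ξ).u ^ 2 + α ξ * (v ξ).relPressure E a) φ
      - π₁ * distDx α φ = 0
  entropy : ∀ φ, IsTest φ →
    distDt (fun ξ => α ξ * (v ξ).ρ * (v ξ).s) φ
      + distDx (fun ξ => α ξ * (v ξ).ρ * (v ξ).s * (v ξ).u) φ = 0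
  rel : ∀ φ, IsTest φ →
    distDt (fun ξ => α ξ * (v ξ).ρ * (v ξ).rel) φ
      + distDx (fun ξ => α ξ * (v ξ).ρ * (v ξ).rel * (v ξ).u) φ = 0
  energy : ∀ φ, IsTest φ →
    distDt (fun ξ => α ξ * (v ξ).ρ * (v ξ).relEnergy E a) φ
      + distDx (fun ξ => α ξ * (v ξ).ρ * (v ξ).relEnergy E a * (v ξ).u
          + α ξ * (v ξ).relPressure E a * (v ξ).u) φ
      - u₂ * π₁ * distDx α φ = -Q * dirac u₂ φ

/-! ### Riemann solutions with subsonic wave ordering -/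

/-- `W(x/t)` is a solution, with subsonic wave ordering, of the relaxation Riemann problem with
data `WL`, `WR`, with interface velocity `u₂`, interface pressure `π₁` and dissipation `Q`. -/
structure IsSubsonicSolution (E : Fin 2 → EOS) (a : Fin 2 → ℝ) (WL WR : State)
    (W : ℝ → State) (u₂ π₁ Q : ℝ) : Prop where
  admissible : ∀ ξ, (W ξ).Admissible E
  /-- `W` is constant between six speeds `σ k j`, hence has at most seven constant states.  The
  speed `σ k j` belongs to the `j`-th eigenvalue of phase `k`, which takes the value `σ k j` on both
  sides of it (contact discontinuity).  The speed of the eigenvalue `u_2` is `u₂`. -/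
  contacts : ∃ σ : Fin 2 → Fin 3 → ℝ, σ 1 1 = u₂ ∧
    (∀ ξ, (∀ k j, ξ ≠ σ k j) → ∀ᶠ η in 𝓝 ξ, W η = W ξ) ∧
    ∀ k j, ∀ᶠ η in 𝓝[≠] (σ k j), ((W η).phase k).eigenvalue (a k) j = σ k j
  left_state : ∀ ξ, (∀ k, ξ < (WL.phase k).u - a k * (WL.phase k).τ) → W ξ = WL
  right_state : ∀ ξ, (∀ k, (WR.phase k).u + a k * (WR.phase k).τ < ξ) → W ξ = WR
  fraction : ∀ k φ, IsTest φ →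
    distDt (fun ξ => (W ξ).frac k) φ + u₂ * distDx (fun ξ => (W ξ).frac k) φ = 0
  fraction_dirac : ∀ k φ, IsTest φ →
    distDx (fun ξ => (W ξ).frac k) φ = (WR.frac k - WL.frac k) * dirac u₂ φ
  equations_one : PhaseEquations (E 0) (a 0) u₂ π₁ Q
    (fun ξ => (W ξ).frac 0) (fun ξ => (W ξ).phase 0)
  equations_two : PhaseEquations (E 1) (a 1) u₂ π₁ 0
    (fun ξ => (W ξ).frac 1) (fun ξ => (W ξ).phase 1)
  dissipation : 0 ≤ Q
  subsonic_left : (WL.phase 0).u - a 0 * (WL.phase 0).τ < u₂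
  subsonic_right : u₂ < (WR.phase 0).u + a 0 * (WR.phase 0).τ

/-! ### Quantities built on the initial data -/

/-- `u♯_k`. -/
def uSharp (E : Fin 2 → EOS) (a : Fin 2 → ℝ) (WL WR : State) (k : Fin 2) : ℝ :=
  ((WL.phase k).u + (WR.phase k).u) / 2
    - ((WR.phase k).relPressure (E k) (a k) - (WL.phase k).relPressure (E k) (a k)) / (2 * a k)

/-- `π♯_k`. -/
def piSharp (E : Fin 2 → EOS) (a : Fin 2 → ℝ) (WL WR : State) (k : Fin 2) : ℝ :=
  ((WR.phase k).relPressure (E k) (a k) + (WL.phase k).relPressure (E k) (a k)) / 2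
    - a k / 2 * ((WR.phase k).u - (WL.phase k).u)

/-- `τ♯_{k,L}`. -/
def tauSharpL (E : Fin 2 → EOS) (a : Fin 2 → ℝ) (WL WR : State) (k : Fin 2) : ℝ :=
  (WL.phase k).τ + (uSharp E a WL WR k - (WL.phase k).u) / a k

/-- `τ♯_{k,R}`. -/
def tauSharpR (E : Fin 2 → EOS) (a : Fin 2 → ℝ) (WL WR : State) (k : Fin 2) : ℝ :=
  (WR.phase k).τ - (uSharp E a WL WR k - (WR.phase k).u) / a k

/-- `Λ^α = (α_{2,R} - α_{2,L}) / (α_{2,R} + α_{2,L})`. -/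
def lambdaAlpha (WL WR : State) : ℝ :=
  (WR.frac 1 - WL.frac 1) / (WR.frac 1 + WL.frac 1)

/-- The central expression of condition (A). -/
def USharp (E : Fin 2 → EOS) (a : Fin 2 → ℝ) (WL WR : State) : ℝ :=
  (uSharp E a WL WR 0 - uSharp E a WL WR 1
      - 1 / a 1 * lambdaAlpha WL WR * (piSharp E a WL WR 0 - piSharp E a WL WR 1))
    / (1 + a 0 / a 1 * |lambdaAlpha WL WR|)

/-- Condition (A). -/
def ConditionA (E : Fin 2 → EOS) (a : Fin 2 → ℝ) (WL WR : State) : Prop :=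
  -(a 0 * tauSharpR E a WL WR 0) < USharp E a WL WR ∧
    USharp E a WL WR < a 0 * tauSharpL E a WL WR 0

/-- Condition (B) on the velocity `u₂` of the phase fraction wave: positivity of the phase 2
densities. -/
def ConditionB (E : Fin 2 → EOS) (a : Fin 2 → ℝ) (WL WR : State) (u₂ : ℝ) : Prop :=
  uSharp E a WL WR 1 - a 1 * tauSharpL E a WL WR 1 < u₂ ∧
    u₂ < uSharp E a WL WR 1 + a 1 * tauSharpR E a WL WR 1

/-! ### The part of a solution that does not require the positivity of the phase 2 densities -/

/-- `v(x/t)` is the phase 1 part of a Riemann solution with subsonic wave ordering: the phase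
fraction `α₁` jumps from its left to its right value at speed `u₂`, phase 1 has all the properties
required in `IsSubsonicSolution`, and the interface pressure `π₁` is the one that phase 2 exerts when
its contact discontinuity moves at speed `u₂`, namely
`π₁ = π♯_2 - a_2 (α_{2,R} + α_{2,L}) / (α_{1,R} - α_{1,L}) (u₂ - u♯_2)` if `α_{1,L} ≠ α_{1,R}`
(and `u₂ = u♯_2` if `α_{1,L} = α_{1,R}`). -/
structure IsPhaseOneSolution (E : Fin 2 → EOS) (a : Fin 2 → ℝ) (WL WR : State)
    (v : ℝ → PhaseState) (u₂ π₁ Q : ℝ) : Prop where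
  admissible : ∀ ξ, (v ξ).Admissible (E 0)
  contacts : ∃ σ : Fin 3 → ℝ,
    (∀ ξ, ξ ≠ u₂ → (∀ j, ξ ≠ σ j) → ∀ᶠ η in 𝓝 ξ, v η = v ξ) ∧
    ∀ j, ∀ᶠ η in 𝓝[≠] (σ j), (v η).eigenvalue (a 0) j = σ j
  left_state : ∀ ξ, ξ < (WL.phase 0).u - a 0 * (WL.phase 0).τ → v ξ = WL.phase 0
  right_state : ∀ ξ, (WR.phase 0).u + a 0 * (WR.phase 0).τ < ξ → v ξ = WR.phase 0
  equations : PhaseEquations (E 0) (a 0) u₂ π₁ Q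
    (fun ξ => if ξ < u₂ then WL.frac 0 else WR.frac 0) v
  coupling : (WR.frac 0 - WL.frac 0) * π₁ =
    (WR.frac 0 - WL.frac 0) * piSharp E a WL WR 1
      - a 1 * (WR.frac 1 + WL.frac 1) * (u₂ - uSharp E a WL WR 1)
  dissipation : 0 ≤ Q
  subsonic_left : (WL.phase 0).u - a 0 * (WL.phase 0).τ < u₂
  subsonic_right : u₂ < (WR.phase 0).u + a 0 * (WR.phase 0).τ

end BaerNunziato

end

/-!
All the characteristic fields of the relaxation system are linearly degenerate, so that solutions
are piecewise constant, and the equations amount to Rankine–Hugoniot relations across each wave.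
The acoustic waves and the contact discontinuities conserve the energy; only the phase fraction
wave, when phase 1 crosses it, can dissipate it.

Suppose that phase 1 crosses the phase fraction wave from the left to the right, with Mach numbers
`M` and `N` before and after the wave. Conservation of mass reads `α_{1,R} N = α_{1,L} M`, and
eliminating the interface pressure between the momentum relation of phase 1 and the pressure exerted
by phase 2 gives `c = u♯₁ - u₂*` as an affine function of `M`. With the positivity of the
intermediate specific volumes, everything is determined by `M`, subject to finitely many
inequalities. If the central quantity `U♯` of condition (A) is positive, then `0 < c ≤ U♯` at
`M = 0`, and `U♯ < a₁ τ♯_{1,L}` makes the positivity and dissipation inequalities strict there;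
hence they hold for every small `M > 0`. If `U♯ = 0`, or if the phase fraction does not jump, there
is a solution with `M = N` and no dissipation. The case `U♯ ≤ 0` follows from the mirror symmetry
`x ↦ -x`, which exchanges the two inequalities of condition (A).

Phase 2 has the velocity `u₂*` on both sides of the phase fraction wave, so `u₂*` alone determines
its intermediate states: their positivity is condition (B), and their momentum relation is the
formula for the interface pressure exerted by phase 2.
-/

noncomputable section

namespace BaerNunziato

/-! ### Test functions -/

theorem integral_mul_fderiv_comp_equiv {F : Type*} [NormedAddCommGroup F] [NormedSpace ℝ F]
    [MeasureSpace F] [BorelSpace F] (e : F ≃L[ℝ] F) (he : MeasurePreserving e)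
    (f φ : F → ℝ) (d : F) :
    ∫ z, f (e z) * fderiv ℝ (φ ∘ e) z d = ∫ z, f z * fderiv ℝ φ z (e d) := by
  simp only [ContinuousLinearEquiv.comp_right_fderiv, ContinuousLinearMap.comp_apply,
    ContinuousLinearEquiv.coe_coe]
  exact he.integral_comp e.toHomeomorph.measurableEmbedding fun z => f z * fderiv ℝ φ z (e d)

namespace IsTest

variable {φ : ℝ × ℝ → ℝ}

theorem differentiableAt (h : IsTest φ) (z : ℝ × ℝ) : DifferentiableAt ℝ φ z :=
  h.1.differentiable (by simp) z

theorem fderiv_eq_zero_of_nonpos (h : IsTest φ) {z : ℝ × ℝ} (hz : z.2 ≤ 0) :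
    fderiv ℝ φ z = 0 :=
  image_eq_zero_of_notMem_tsupport fun hm => (h.2.2 (tsupport_fderiv_subset ℝ hm)).not_ge hz

theorem integrable_fderiv_apply (h : IsTest φ) (d : ℝ × ℝ) :
    Integrable fun z => fderiv ℝ φ z d :=
  ((h.1.continuous_fderiv (by simp)).clm_apply continuous_const).integrable_of_hasCompactSupport
    (h.2.1.fderiv_apply ℝ d)

theorem integrable_mul_fderiv_apply (h : IsTest φ) {f : ℝ → ℝ} (hf : Measurable f) {C : ℝ}
    (hC : ∀ ξ, |f ξ| ≤ C) (d : ℝ × ℝ) :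
    Integrable fun z : ℝ × ℝ => f (z.1 / z.2) * fderiv ℝ φ z d :=
  (h.integrable_fderiv_apply d).bdd_mul (c := C)
    (hf.comp (measurable_fst.div measurable_snd)).aestronglyMeasurable
    (.of_forall fun z => by simpa using hC _)

theorem comp_equiv (h : IsTest φ) (e : (ℝ × ℝ) ≃L[ℝ] ℝ × ℝ) (he : ∀ z, (e z).2 = z.2) :
    IsTest (φ ∘ e) := by
  refine ⟨h.1.comp e.contDiff, h.2.1.comp_homeomorph e.toHomeomorph, fun z hz => ?_⟩
  have hez : 0 < (e z).2 := h.2.2 ((tsupport_comp_eq_preimage φ e.toHomeomorph).subset hz)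
  rwa [he] at hez

theorem hasDerivAt_fst (h : IsTest φ) (x t : ℝ) :
    HasDerivAt (fun x => φ (x, t)) (fderiv ℝ φ (x, t) (1, 0)) x :=
  (h.differentiableAt (x, t)).hasFDerivAt.comp_hasDerivAt x
    ((hasDerivAt_id x).prodMk (hasDerivAt_const x t))

theorem hasDerivAt_snd (h : IsTest φ) (x t : ℝ) :
    HasDerivAt (fun t => φ (x, t)) (fderiv ℝ φ (x, t) (0, 1)) t :=
  (h.differentiableAt (x, t)).hasFDerivAt.comp_hasDerivAt t
    ((hasDerivAt_const t x).prodMk (hasDerivAt_id t))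

theorem contDiff_fst (h : IsTest φ) (t : ℝ) : ContDiff ℝ 1 fun x => φ (x, t) :=
  (h.1.of_le (by simp)).comp (contDiff_id.prodMk contDiff_const)

theorem contDiff_snd (h : IsTest φ) (x : ℝ) : ContDiff ℝ 1 fun t => φ (x, t) :=
  (h.1.of_le (by simp)).comp (contDiff_const.prodMk contDiff_id)

theorem hasCompactSupport_fst (h : IsTest φ) (t : ℝ) : HasCompactSupport fun x => φ (x, t) :=
  h.2.1.comp_isClosedEmbedding <| IsClosedEmbedding.of_continuous_injective_isClosedMap
    (by fun_prop) (Prod.mk_left_injective t) (isClosedMap_prodMk_right t)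

theorem hasCompactSupport_snd (h : IsTest φ) (x : ℝ) : HasCompactSupport fun t => φ (x, t) :=
  h.2.1.comp_isClosedEmbedding <| IsClosedEmbedding.of_continuous_injective_isClosedMap
    (by fun_prop) (Prod.mk_right_injective x) (isClosedMap_prodMk_left x)

theorem integral_fderiv_apply_snd (h : IsTest φ) (x : ℝ) :
    ∫ t, fderiv ℝ φ (x, t) (0, 1) = 0 := by
  have hφ := h.contDiff_snd x
  have hc := h.hasCompactSupport_snd x
  simp only [← (h.hasDerivAt_snd x _).deriv]
  exact integral_eq_zero_of_hasDerivAt_of_integrable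
    (fun t => (hφ.differentiable one_ne_zero t).hasDerivAt)
    ((hφ.continuous_deriv le_rfl).integrable_of_hasCompactSupport hc.deriv)
    (hφ.continuous.integrable_of_hasCompactSupport hc)

theorem integral_Iio_fderiv_apply_fst (h : IsTest φ) (b t : ℝ) :
    ∫ x in Iio b, fderiv ℝ φ (x, t) (1, 0) = φ (b, t) := by
  simp only [← (h.hasDerivAt_fst _ t).deriv, ← integral_Iic_eq_integral_Iio]
  exact (h.hasCompactSupport_fst t).integral_Iic_deriv_eq (h.contDiff_fst t) b

theorem integral_fderiv_apply (h : IsTest φ) (d : ℝ × ℝ) : ∫ z, fderiv ℝ φ z d = 0 := by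
  simpa using integral_mul_fderiv_eq_neg_fderiv_mul_of_integrable (μ := volume)
    (f := fun _ : ℝ × ℝ => (1 : ℝ)) (g := φ) (v := d) (by simp)
    (by simpa using h.integrable_fderiv_apply d)
    (by simpa using h.1.continuous.integrable_of_hasCompactSupport h.2.1)
    (by simp) (fun z _ => h.differentiableAt z)

end IsTest

/-! ### Self-similar distributions -/

/-- The change of frame `(x, t) ↦ (x + ct, t)`. -/
def galilean (c : ℝ) : (ℝ × ℝ) ≃L[ℝ] ℝ × ℝ :=
  .equivOfInverse
    ((ContinuousLinearMap.fst ℝ ℝ ℝ + c • ContinuousLinearMap.snd ℝ ℝ ℝ).prod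
      (ContinuousLinearMap.snd ℝ ℝ ℝ))
    ((ContinuousLinearMap.fst ℝ ℝ ℝ - c • ContinuousLinearMap.snd ℝ ℝ ℝ).prod
      (ContinuousLinearMap.snd ℝ ℝ ℝ))
    (fun z => by simp) (fun z => by simp)

@[simp]
theorem galilean_apply (c : ℝ) (z : ℝ × ℝ) : galilean c z = (z.1 + c * z.2, z.2) := rfl

theorem measurePreserving_galilean (c : ℝ) : MeasurePreserving (galilean c) := by
  have h : MeasurePreserving (fun z : ℝ × ℝ => (z.1, z.2 + c * z.1))
      (volume.prod volume) (volume.prod volume) :=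
    (MeasurePreserving.id volume).skew_product (g := fun t x => x + c * t) (by fun_prop)
      (.of_forall fun t => map_add_right_eq_self volume (c * t))
  exact (Measure.measurePreserving_swap.comp h).comp Measure.measurePreserving_swap

/-- The reflection `(x, t) ↦ (-x, t)`. -/
def reflection : (ℝ × ℝ) ≃L[ℝ] ℝ × ℝ :=
  (ContinuousLinearEquiv.neg ℝ).prodCongr (.refl ℝ ℝ)

@[simp]
theorem reflection_apply (z : ℝ × ℝ) : reflection z = (-z.1, z.2) := rfl

theorem measurePreserving_reflection : MeasurePreserving reflection :=
  (Measure.measurePreserving_neg volume).prod (.id volume)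

theorem IsTest.comp_galilean {φ : ℝ × ℝ → ℝ} (h : IsTest φ) (c : ℝ) :
    IsTest (φ ∘ galilean c) :=
  h.comp_equiv _ fun _ => rfl

theorem IsTest.comp_reflection {φ : ℝ × ℝ → ℝ} (h : IsTest φ) : IsTest (φ ∘ reflection) :=
  h.comp_equiv _ fun _ => rfl

section Frames

variable {φ : ℝ × ℝ → ℝ}

theorem integral_comp_galilean (f : ℝ → ℝ) (c : ℝ) (h : IsTest φ) (d : ℝ × ℝ) :
    ∫ z : ℝ × ℝ, f (z.1 / z.2 + c) * fderiv ℝ (φ ∘ galilean c) z d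
      = ∫ z : ℝ × ℝ, f (z.1 / z.2) * fderiv ℝ φ z (galilean c d) := by
  rw [← integral_mul_fderiv_comp_equiv _ (measurePreserving_galilean c)
    fun z => f (z.1 / z.2)]
  refine integral_congr_ae (.of_forall fun z => ?_)
  rcases le_or_gt z.2 0 with hz | hz
  · simp only [(h.comp_galilean c).fderiv_eq_zero_of_nonpos hz, zero_apply, mul_zero]
  · simp only [galilean_apply, add_div, mul_div_cancel_right₀ c hz.ne']

theorem distDt_comp_galilean (h : IsTest φ) {f : ℝ → ℝ} (hf : Measurable f) {C : ℝ}
    (hC : ∀ ξ, |f ξ| ≤ C) (c : ℝ) :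
    distDt (fun ξ => f (ξ + c)) (φ ∘ galilean c) = distDt f φ + c * distDx f φ := by
  have hdir (z : ℝ × ℝ) :
      fderiv ℝ φ z (galilean c (0, 1)) = fderiv ℝ φ z (0, 1) + c * fderiv ℝ φ z (1, 0) := by
    rw [← smul_eq_mul, ← map_smul, ← map_add]
    simp
  have hint := h.integrable_mul_fderiv_apply hf hC
  simp only [distDt, distDx, integral_comp_galilean f c h, hdir, mul_add, mul_left_comm _ c]
  rw [integral_add (hint _) ((hint _).const_mul c), integral_const_mul]
  ring

theorem distDx_comp_neg (f : ℝ → ℝ) (φ : ℝ × ℝ → ℝ) :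
    distDx (fun ξ => f (-ξ)) φ = -distDx f (φ ∘ reflection) := by
  have h := integral_mul_fderiv_comp_equiv _ measurePreserving_reflection
    (fun z => f (-(z.1 / z.2))) φ (1, 0)
  have hneg (z : ℝ × ℝ) : fderiv ℝ φ z (-1, 0) = -fderiv ℝ φ z (1, 0) := by
    rw [← map_neg, Prod.neg_mk, neg_zero]
  simp only [reflection_apply, neg_div, neg_neg, hneg, mul_neg, integral_neg] at h
  rw [distDx, distDx, h, neg_neg]

theorem distDt_comp_neg (f : ℝ → ℝ) (φ : ℝ × ℝ → ℝ) :
    distDt (fun ξ => f (-ξ)) φ = distDt f (φ ∘ reflection) := by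
  have h := integral_mul_fderiv_comp_equiv _ measurePreserving_reflection
    (fun z => f (-(z.1 / z.2))) φ (0, 1)
  simp only [reflection_apply, neg_div, neg_neg, neg_zero] at h
  rw [distDt, distDt, h]

theorem distDx_neg (f : ℝ → ℝ) (φ : ℝ × ℝ → ℝ) : distDx (fun ξ => -f ξ) φ = -distDx f φ := by
  simp only [distDx, neg_mul, integral_neg]

theorem distDt_neg (f : ℝ → ℝ) (φ : ℝ × ℝ → ℝ) : distDt (fun ξ => -f ξ) φ = -distDt f φ := by
  simp only [distDt, neg_mul, integral_neg]

theorem dirac_neg (c : ℝ) (φ : ℝ × ℝ → ℝ) : dirac (-c) φ = dirac c (φ ∘ reflection) := by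
  simp [dirac]

theorem ae_div_ne (c : ℝ) : ∀ᵐ z : ℝ × ℝ, z.1 / z.2 ≠ c := by
  have hmeas : MeasurableSet {z : ℝ × ℝ | z.1 / z.2 = c} :=
    measurableSet_eq_fun (by fun_prop) measurable_const
  have hnull : volume {z : ℝ × ℝ | z.1 / z.2 = c} = 0 := by
    rw [Measure.volume_eq_prod, Measure.measure_prod_null hmeas]
    filter_upwards [volume.ae_ne (0 : ℝ)] with x hx
    refine Subsingleton.measure_zero (fun t ht t' ht' => ?_) volume
    exact inv_injective (mul_left_cancel₀ hx (Eq.trans ht (Eq.symm ht')))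
  exact measure_eq_zero_iff_ae_notMem.1 hnull

theorem distDx_congr {f g : ℝ → ℝ} {c : ℝ} (hfg : ∀ ξ ≠ c, f ξ = g ξ) (φ : ℝ × ℝ → ℝ) :
    distDx f φ = distDx g φ := by
  rw [distDx, distDx, integral_congr_ae]
  filter_upwards [ae_div_ne c] with z hz
  rw [hfg _ hz]

theorem distDt_congr {f g : ℝ → ℝ} {c : ℝ} (hfg : ∀ ξ ≠ c, f ξ = g ξ) (φ : ℝ × ℝ → ℝ) :
    distDt f φ = distDt g φ := by
  rw [distDt, distDt, integral_congr_ae]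
  filter_upwards [ae_div_ne c] with z hz
  rw [hfg _ hz]

end Frames

/-! ### Step functions -/

section Step

variable {φ : ℝ × ℝ → ℝ}

theorem measurable_indicator_Iio (c : ℝ) : Measurable ((Iio c).indicator (1 : ℝ → ℝ)) :=
  measurable_one.indicator measurableSet_Iio

theorem abs_indicator_Iio_le (c ξ : ℝ) : |(Iio c).indicator (1 : ℝ → ℝ) ξ| ≤ 1 := by
  rw [indicator_apply]
  split_ifs <;> simp

theorem distDx_indicator_Iio (h : IsTest φ) (c : ℝ) :
    distDx ((Iio c).indicator 1) φ = -dirac c φ := by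
  have hint := h.integrable_mul_fderiv_apply (measurable_indicator_Iio c)
    (abs_indicator_Iio_le c) (1, 0)
  rw [distDx, dirac, neg_inj, Measure.volume_eq_prod, integral_prod_symm _ hint,
    ← setIntegral_eq_integral_of_forall_compl_eq_zero (s := Ioi 0)]
  · refine setIntegral_congr_fun measurableSet_Ioi fun t (ht : 0 < t) => ?_
    rw [← h.integral_Iio_fderiv_apply_fst, ← integral_indicator measurableSet_Iio]
    simp only [indicator_apply, mem_Iio, div_lt_iff₀ ht, Pi.one_apply, ite_mul, one_mul, zero_mul]
  · intro t ht
    simp [h.fderiv_eq_zero_of_nonpos (z := (_, t)) (not_lt.1 ht)]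

theorem distDt_indicator_Iio_zero (h : IsTest φ) : distDt ((Iio 0).indicator 1) φ = 0 := by
  have hstep (z : ℝ × ℝ) : (Iio 0).indicator 1 (z.1 / z.2) * fderiv ℝ φ z (0, 1)
      = (Iio 0).indicator 1 z.1 * fderiv ℝ φ z (0, 1) := by
    rcases le_or_gt z.2 0 with hz | hz
    · simp [h.fderiv_eq_zero_of_nonpos hz]
    · simp [indicator_apply, div_lt_iff₀ hz]
  have hint := h.integrable_mul_fderiv_apply (measurable_indicator_Iio 0)
    (abs_indicator_Iio_le 0) (0, 1)
  simp only [hstep, Measure.volume_eq_prod] at hint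
  simp only [distDt, hstep, Measure.volume_eq_prod, integral_prod _ hint, integral_const_mul,
    h.integral_fderiv_apply_snd, mul_zero, integral_zero, neg_zero]

-- In the frame moving with the jump the step function does not depend on time.
theorem distDt_indicator_Iio (h : IsTest φ) (c : ℝ) :
    distDt ((Iio c).indicator 1) φ = c * dirac c φ := by
  have hframe := distDt_comp_galilean h (measurable_indicator_Iio c) (abs_indicator_Iio_le c) c
  have hstep : (fun ξ => (Iio c).indicator (1 : ℝ → ℝ) (ξ + c)) = (Iio 0).indicator 1 := by
    ext ξ
    simp [indicator_apply]
  rw [hstep, distDt_indicator_Iio_zero (h.comp_galilean c), distDx_indicator_Iio h] at hframe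
  linear_combination -hframe

end Step

/-! ### Piecewise constant functions of the similarity variable -/

section Fan

variable {X : Type*}

/-- The piecewise constant function of `ξ = x/t` with value `w` on the left of the first listed
speed, and with the state listed next to a speed on the right of that speed.  The values at the
speeds themselves are the right ones. -/
def fan (w : X) : List (ℝ × X) → ℝ → X
  | [], _ => w
  | (s, w') :: l, ξ => if ξ < s then w else fan w' l ξ

/-- The jumps of a fan: the triples of a speed, the state on its left and the state on its right.
If several listed speeds coincide, the intermediate states are kept. -/
def jumps (w : X) : List (ℝ × X) → List (ℝ × X × X)
  | [] => []
  | (s, w') :: l => (s, w, w') :: jumps w' l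

/-- The speeds of a fan are in nondecreasing order. -/
def SpeedsSorted (l : List (ℝ × X)) : Prop :=
  l.Pairwise fun p q => p.1 ≤ q.1

theorem fan_of_forall_lt {w : X} {l : List (ℝ × X)} {ξ : ℝ} (h : ∀ p ∈ l, ξ < p.1) :
    fan w l ξ = w := by
  cases l with
  | nil => rfl
  | cons p l => exact if_pos (h p List.mem_cons_self)

theorem forall_fan {P : X → Prop} {w : X} {l : List (ℝ × X)} (hw : P w)
    (hl : ∀ p ∈ l, P p.2) (ξ : ℝ) : P (fan w l ξ) := by
  induction l generalizing w with
  | nil => exact hw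
  | cons p l ih =>
    rw [List.forall_mem_cons] at hl
    unfold fan
    split_ifs
    · exact hw
    · exact ih hl.1 hl.2

theorem fan_cons_of_lt {w w' : X} {l : List (ℝ × X)} {s ξ : ℝ} (h : ξ < s) :
    fan w ((s, w') :: l) ξ = w :=
  if_pos h

theorem fan_cons_of_le {w w' : X} {l : List (ℝ × X)} {s ξ : ℝ} (h : s ≤ ξ) :
    fan w ((s, w') :: l) ξ = fan w' l ξ :=
  if_neg h.not_gt

theorem fan_of_forall_le {w : X} {l : List (ℝ × X)} {ξ : ℝ} (h : ∀ p ∈ l, p.1 ≤ ξ) :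
    fan w l ξ = (w :: l.map Prod.snd).getLast (List.cons_ne_nil _ _) := by
  induction l generalizing w with
  | nil => rfl
  | cons p l ih =>
    rw [List.forall_mem_cons] at h
    rw [fan_cons_of_le h.1, ih h.2]
    rfl

theorem eventually_fan_eq {w : X} {l : List (ℝ × X)} {ξ : ℝ} (h : ∀ p ∈ l, ξ ≠ p.1) :
    ∀ᶠ η in 𝓝 ξ, fan w l η = fan w l ξ := by
  induction l generalizing w with
  | nil => exact .of_forall fun _ => rfl
  | cons p l ih =>
    rw [List.forall_mem_cons] at h
    rcases h.1.lt_or_gt with hp | hp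
    · filter_upwards [eventually_lt_nhds hp] with η hη
      rw [fan_cons_of_lt hη, fan_cons_of_lt hp]
    · filter_upwards [eventually_gt_nhds hp, ih h.2] with η hη hfan
      rw [fan_cons_of_le hη.le, fan_cons_of_le hp.le, hfan]

theorem eventually_nhdsNE_fan {P : X → Prop} {w : X} {l : List (ℝ × X)} {s : ℝ}
    (hl : SpeedsSorted l) (hs : s ∈ l.map Prod.fst)
    (hP : ∀ j ∈ jumps w l, s = j.1 → P j.2.1 ∧ P j.2.2) :
    ∀ᶠ η in 𝓝[≠] s, P (fan w l η) := by
  induction l generalizing w with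
  | nil => simp at hs
  | cons p l ih =>
    obtain ⟨t, w'⟩ := p
    obtain ⟨ht, hl⟩ := List.pairwise_cons.1 hl
    obtain ⟨hPt, hP⟩ := List.forall_mem_cons.1 hP
    rw [List.map_cons, List.mem_cons] at hs
    have hright : s = t ∨ s ∈ l.map Prod.fst → ∀ᶠ η in 𝓝[≠] s, P (fan w' l η) := by
      intro hs
      by_cases hsl : s ∈ l.map Prod.fst
      · exact ih hl hsl hP
      obtain rfl := hs.resolve_right hsl
      have hne : ∀ p ∈ l, s ≠ p.1 := fun p hp h => hsl (h ▸ List.mem_map_of_mem hp)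
      have hw' : fan w' l s = w' := fan_of_forall_lt fun p hp => (ht p hp).lt_of_ne (hne p hp)
      filter_upwards [nhdsWithin_le_nhds (eventually_fan_eq (w := w') hne)] with η hη
      rw [hη, hw']
      exact (hPt rfl).2
    have hts : t ≤ s := by
      rcases hs with rfl | hs
      · exact le_rfl
      · obtain ⟨p, hp, rfl⟩ := List.mem_map.1 hs
        exact ht p hp
    rcases hts.eq_or_lt with rfl | hts
    · filter_upwards [hright hs, self_mem_nhdsWithin] with η hη hne
      rcases lt_or_gt_of_ne hne with hlt | hlt
      · exact (fan_cons_of_lt hlt).symm ▸ (hPt rfl).1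
      · rwa [fan_cons_of_le hlt.le]
    · filter_upwards [hright hs, nhdsWithin_le_nhds (eventually_gt_nhds hts)] with η hη hlt
      rwa [fan_cons_of_le hlt.le]

theorem apply_fan_cons (f : X → ℝ) (w : X) {s : ℝ} {w' : X} {l : List (ℝ × X)}
    (hl : SpeedsSorted ((s, w') :: l)) (ξ : ℝ) :
    f (fan w ((s, w') :: l) ξ) = (f w - f w') * (Iio s).indicator 1 ξ + f (fan w' l ξ) := by
  rcases lt_or_ge ξ s with h | h
  · have hw' : fan w' l ξ = w' :=
      fan_of_forall_lt fun p hp => h.trans_le ((List.pairwise_cons.1 hl).1 p hp)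
    simp [fan_cons_of_lt h, hw', h]
  · simp [fan_cons_of_le h, h]

section Balance

variable {φ : ℝ × ℝ → ℝ} {w : X} {l : List (ℝ × X)}

theorem IsTest.integrable_fan_mul_fderiv_apply (h : IsTest φ) (d : ℝ × ℝ) (f : X → ℝ)
    (hl : SpeedsSorted l) :
    Integrable fun z : ℝ × ℝ => f (fan w l (z.1 / z.2)) * fderiv ℝ φ z d := by
  induction l generalizing w with
  | nil => exact (h.integrable_fderiv_apply d).const_mul (f w)
  | cons p l ih =>
    have hstep := h.integrable_mul_fderiv_apply (measurable_indicator_Iio p.1)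
      (abs_indicator_Iio_le p.1) d
    simp only [apply_fan_cons f w hl, add_mul, mul_assoc]
    exact (hstep.const_mul _).add (ih (List.pairwise_cons.1 hl).2)

theorem IsTest.neg_integral_fan_mul_fderiv_apply (h : IsTest φ) (d : ℝ × ℝ) (f : X → ℝ)
    (hl : SpeedsSorted l) :
    -∫ z : ℝ × ℝ, f (fan w l (z.1 / z.2)) * fderiv ℝ φ z d
      = ((jumps w l).map fun j => (f j.2.1 - f j.2.2)
          * -∫ z : ℝ × ℝ, (Iio j.1).indicator 1 (z.1 / z.2) * fderiv ℝ φ z d).sum := by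
  induction l generalizing w with
  | nil => simp [fan, jumps, integral_const_mul, h.integral_fderiv_apply]
  | cons p l ih =>
    have hl' := (List.pairwise_cons.1 hl).2
    have hstep := h.integrable_mul_fderiv_apply (measurable_indicator_Iio p.1)
      (abs_indicator_Iio_le p.1) d
    simp only [apply_fan_cons f w hl, add_mul, mul_assoc]
    rw [integral_add (hstep.const_mul _) (h.integrable_fan_mul_fderiv_apply d f hl'),
      integral_const_mul, neg_add, ih hl', jumps, List.map_cons, List.sum_cons, mul_neg]

theorem distDx_fan (h : IsTest φ) (f : X → ℝ) (hl : SpeedsSorted l) :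
    distDx (fun ξ => f (fan w l ξ)) φ
      = ((jumps w l).map fun j => (f j.2.2 - f j.2.1) * dirac j.1 φ).sum := by
  have hstep (c : ℝ) := distDx_indicator_Iio h c
  unfold distDx at hstep ⊢
  simp only [h.neg_integral_fan_mul_fderiv_apply _ f hl, hstep, mul_neg, ← neg_mul, neg_sub]

theorem distDt_fan (h : IsTest φ) (f : X → ℝ) (hl : SpeedsSorted l) :
    distDt (fun ξ => f (fan w l ξ)) φ
      = ((jumps w l).map fun j => (f j.2.1 - f j.2.2) * (j.1 * dirac j.1 φ)).sum := by
  have hstep (c : ℝ) := distDt_indicator_Iio h c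
  unfold distDt at hstep ⊢
  simp only [h.neg_integral_fan_mul_fderiv_apply _ f hl, hstep]

theorem balance_fan (h : IsTest φ) (f g r : X → ℝ) (c : ℝ) (hl : SpeedsSorted l) :
    distDt (fun ξ => f (fan w l ξ)) φ + distDx (fun ξ => g (fan w l ξ)) φ
        - c * distDx (fun ξ => r (fan w l ξ)) φ
      = ((jumps w l).map fun j => (g j.2.2 - g j.2.1 - j.1 * (f j.2.2 - f j.2.1)
          - c * (r j.2.2 - r j.2.1)) * dirac j.1 φ).sum := by
  rw [distDt_fan h f hl, distDx_fan h g hl, distDx_fan h r hl, sub_eq_add_neg, ← neg_mul,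
    ← List.sum_map_mul_left, ← List.sum_map_add, ← List.sum_map_add]
  congr 2
  ext j
  ring

end Balance

end Fan

/-! ### Jump relations of one phase -/

/-- Rankine–Hugoniot relations at speed `σ` for the mass, momentum, entropy and relaxation
equations of one phase, between the pairs `w`, `w'` of a phase fraction and a phase state. -/
structure RankineHugoniot (E : EOS) (a π₁ σ : ℝ) (w w' : ℝ × PhaseState) : Prop where
  mass : w'.1 * w'.2.ρ * (w'.2.u - σ) = w.1 * w.2.ρ * (w.2.u - σ)
  momentum : w'.1 * (w'.2.ρ * w'.2.u * (w'.2.u - σ) + w'.2.relPressure E a)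
      - w.1 * (w.2.ρ * w.2.u * (w.2.u - σ) + w.2.relPressure E a) = π₁ * (w'.1 - w.1)
  entropy : w'.1 * w'.2.ρ * w'.2.s * (w'.2.u - σ) = w.1 * w.2.ρ * w.2.s * (w.2.u - σ)
  rel : w'.1 * w'.2.ρ * w'.2.rel * (w'.2.u - σ) = w.1 * w.2.ρ * w.2.rel * (w.2.u - σ)

/-- The defect of the Rankine–Hugoniot relation of the energy equation across a jump of
speed `σ`. -/
def energyDefect (E : EOS) (a u₂ π₁ σ : ℝ) (w w' : ℝ × PhaseState) : ℝ :=
  w'.1 * (w'.2.ρ * w'.2.relEnergy E a * (w'.2.u - σ) + w'.2.relPressure E a * w'.2.u)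
    - w.1 * (w.2.ρ * w.2.relEnergy E a * (w.2.u - σ) + w.2.relPressure E a * w.2.u)
    - u₂ * π₁ * (w'.1 - w.1)

theorem phaseEquations_fan {E : EOS} {a u₂ π₁ Q : ℝ} {w : ℝ × PhaseState}
    {l : List (ℝ × (ℝ × PhaseState))} (hl : SpeedsSorted l)
    (hRH : ∀ j ∈ jumps w l, RankineHugoniot E a π₁ j.1 j.2.1 j.2.2)
    (hQ : ∀ δ : ℝ → ℝ,
      ((jumps w l).map fun j => energyDefect E a u₂ π₁ j.1 j.2.1 j.2.2 * δ j.1).sum = -Q * δ u₂) :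
    PhaseEquations E a u₂ π₁ Q (fun ξ => (fan w l ξ).1) (fun ξ => (fan w l ξ).2) := by
  have hbalance (φ) (hφ : IsTest φ) (f g : ℝ × PhaseState → ℝ) (c : ℝ) :=
    balance_fan (w := w) hφ f g Prod.fst c hl
  have hconservative (φ) (hφ : IsTest φ) (f g : ℝ × PhaseState → ℝ) (c : ℝ)
      (hfg : ∀ j ∈ jumps w l,
        g j.2.2 - g j.2.1 - j.1 * (f j.2.2 - f j.2.1) - c * (j.2.2.1 - j.2.1.1) = 0) :
      distDt (fun ξ => f (fan w l ξ)) φ + distDx (fun ξ => g (fan w l ξ)) φ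
        - c * distDx (fun ξ => (fan w l ξ).1) φ = 0 := by
    rw [hbalance φ hφ f g c]
    refine List.sum_eq_zero fun x hx => ?_
    obtain ⟨j, hj, rfl⟩ := List.mem_map.1 hx
    rw [hfg j hj, zero_mul]
  constructor <;> intro φ hφ
  · simpa using hconservative φ hφ (fun w => w.1 * w.2.ρ) (fun w => w.1 * w.2.ρ * w.2.u) 0
      fun j hj => by linear_combination (hRH j hj).mass
  · exact hconservative φ hφ (fun w => w.1 * w.2.ρ * w.2.u)
      (fun w => w.1 * w.2.ρ * w.2.u ^ 2 + w.1 * w.2.relPressure E a) π₁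
      fun j hj => by linear_combination (hRH j hj).momentum
  · simpa using hconservative φ hφ (fun w => w.1 * w.2.ρ * w.2.s)
      (fun w => w.1 * w.2.ρ * w.2.s * w.2.u) 0
      fun j hj => by linear_combination (hRH j hj).entropy
  · simpa using hconservative φ hφ (fun w => w.1 * w.2.ρ * w.2.rel)
      (fun w => w.1 * w.2.ρ * w.2.rel * w.2.u) 0
      fun j hj => by linear_combination (hRH j hj).rel
  · refine (hbalance φ hφ (fun w => w.1 * w.2.ρ * w.2.relEnergy E a)
      (fun w => w.1 * w.2.ρ * w.2.relEnergy E a * w.2.u + w.1 * w.2.relPressure E a * w.2.u)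
      (u₂ * π₁)).trans ?_
    rw [← hQ fun c => dirac c φ]
    congr 2
    ext j
    unfold energyDefect
    ring

/-- A jump at speed `σ` across which the entropy and the relaxation unknown do not jump, and the
mass and momentum relations hold; the latter is written with the mass flux in factor of the
velocity jump. -/
structure TransportedJump (E : EOS) (a π₁ σ : ℝ) (w w' : ℝ × PhaseState) : Prop where
  s_eq : w'.2.s = w.2.s
  rel_eq : w'.2.rel = w.2.rel
  mass : w'.1 * w'.2.ρ * (w'.2.u - σ) = w.1 * w.2.ρ * (w.2.u - σ)
  momentum : w.1 * w.2.ρ * (w.2.u - σ) * (w'.2.u - w.2.u)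
      + (w'.1 * w'.2.relPressure E a - w.1 * w.2.relPressure E a) = π₁ * (w'.1 - w.1)

theorem relPressure_sub_of_eq {E : EOS} {a : ℝ} {v v' : PhaseState} (hs : v'.s = v.s)
    (hrel : v'.rel = v.rel) :
    v'.relPressure E a - v.relPressure E a = a ^ 2 * (v.τ - v'.τ) := by
  simp only [PhaseState.relPressure, hs, hrel]
  ring

namespace TransportedJump

variable {E : EOS} {a π₁ σ : ℝ} {w w' : ℝ × PhaseState}

theorem rankineHugoniot (h : TransportedJump E a π₁ σ w w') : RankineHugoniot E a π₁ σ w w' where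
  mass := h.mass
  momentum := by linear_combination h.momentum + w'.2.u * h.mass
  entropy := by rw [h.s_eq]; linear_combination w.2.s * h.mass
  rel := by rw [h.rel_eq]; linear_combination w.2.rel * h.mass

theorem relEnergy_sub (h : TransportedJump E a π₁ σ w w') (ha : a ≠ 0) :
    w'.2.relEnergy E a - w.2.relEnergy E a = (w'.2.u ^ 2 - w.2.u ^ 2) / 2
      + (w'.2.relPressure E a + w.2.relPressure E a) / 2 * (w.2.τ - w'.2.τ) := by
  have hπ := relPressure_sub_of_eq (E := E) (a := a) h.s_eq h.rel_eq
  simp only [PhaseState.relEnergy, h.s_eq, h.rel_eq]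
  field_simp
  linear_combination (w'.2.relPressure E a + w.2.relPressure E a) * hπ

theorem energyDefect_eq (h : TransportedJump E a π₁ σ w w') (ha : a ≠ 0) (hρ : w.2.ρ ≠ 0)
    (hρ' : w'.2.ρ ≠ 0) {u₂ : ℝ} (hσ : (σ - u₂) * (w'.1 - w.1) = 0) :
    energyDefect E a u₂ π₁ σ w w' = w.1 * w.2.ρ * (w.2.u - σ) / 2
      * (((w'.2.u - σ) ^ 2 - (a * w'.2.τ) ^ 2) - ((w.2.u - σ) ^ 2 - (a * w.2.τ) ^ 2)) := by
  have hπ := relPressure_sub_of_eq (E := E) (a := a) h.s_eq h.rel_eq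
  have hvol : w.2.ρ * w.2.τ = 1 := mul_inv_cancel₀ hρ
  have hvol' : w'.2.ρ * w'.2.τ = 1 := mul_inv_cancel₀ hρ'
  unfold energyDefect
  linear_combination w'.2.relEnergy E a * h.mass + w.1 * w.2.ρ * (w.2.u - σ) * h.relEnergy_sub ha
    + σ * h.momentum + π₁ * hσ
    + w'.2.relPressure E a * (-w'.1 * (w'.2.u - σ) * hvol' + w'.2.τ * h.mass)
    + w.1 * w.2.relPressure E a * (w.2.u - σ) * hvol
    + w.1 * w.2.ρ * (w.2.u - σ) / 2 * (w.2.τ + w'.2.τ) * hπ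

end TransportedJump

section ElementaryWaves

variable {E : EOS} {a π₁ σ : ℝ}

theorem transportedJump_acoustic {α ε : ℝ} {v v' : PhaseState} (hε : ε ^ 2 = 1)
    (hρ : v.ρ ≠ 0) (hρ' : v'.ρ ≠ 0) (hs : v'.s = v.s) (hrel : v'.rel = v.rel)
    (hv : v.u + ε * a * v.τ = σ) (hv' : v'.u + ε * a * v'.τ = σ) :
    TransportedJump E a π₁ σ (α, v) (α, v') where
  s_eq := hs
  rel_eq := hrel
  mass := by
    have hvol : v.ρ * v.τ = 1 := mul_inv_cancel₀ hρ
    have hvol' : v'.ρ * v'.τ = 1 := mul_inv_cancel₀ hρ'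
    linear_combination α * v'.ρ * hv' - α * v.ρ * hv + α * ε * a * (hvol - hvol')
  momentum := by
    have hvol : v.ρ * v.τ = 1 := mul_inv_cancel₀ hρ
    have hπ := relPressure_sub_of_eq (E := E) (a := a) hs hrel
    linear_combination α * hπ + α * v.ρ * (v'.u - v.u) * hv - α * ε * a * (v'.u - v.u) * hvol
      - α * ε * a * (hv' - hv) + α * a ^ 2 * (v'.τ - v.τ) * hε

theorem acoustic_wave {α ε u₂ : ℝ} {v v' : PhaseState} (ha : a ≠ 0) (hε : ε ^ 2 = 1)
    (hρ : v.ρ ≠ 0) (hρ' : v'.ρ ≠ 0) (hs : v'.s = v.s) (hrel : v'.rel = v.rel)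
    (hv : v.u + ε * a * v.τ = σ) (hv' : v'.u + ε * a * v'.τ = σ) :
    RankineHugoniot E a π₁ σ (α, v) (α, v') ∧
      energyDefect E a u₂ π₁ σ (α, v) (α, v') = 0 := by
  have hjump := transportedJump_acoustic (E := E) (π₁ := π₁) (α := α) hε hρ hρ' hs hrel hv hv'
  have hsq : (v.u - σ) ^ 2 = (a * v.τ) ^ 2 := by
    linear_combination (v.u - σ - ε * a * v.τ) * hv + (a * v.τ) ^ 2 * hε
  have hsq' : (v'.u - σ) ^ 2 = (a * v'.τ) ^ 2 := by
    linear_combination (v'.u - σ - ε * a * v'.τ) * hv' + (a * v'.τ) ^ 2 * hε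
  refine ⟨hjump.rankineHugoniot, ?_⟩
  rw [hjump.energyDefect_eq ha hρ hρ' (by simp), hsq, hsq', sub_self, sub_self, sub_self, mul_zero]

theorem contact_wave {w w' : ℝ × PhaseState} {u₂ : ℝ} (hu : w.2.u = σ) (hu' : w'.2.u = σ)
    (hπ : w'.1 * w'.2.relPressure E a - w.1 * w.2.relPressure E a = π₁ * (w'.1 - w.1))
    (hσ : (σ - u₂) * (w'.1 - w.1) = 0) :
    RankineHugoniot E a π₁ σ w w' ∧ energyDefect E a u₂ π₁ σ w w' = 0 := by
  refine ⟨by constructor <;> simp [hu, hu', hπ], ?_⟩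
  simp only [energyDefect, hu, hu', sub_self, mul_zero, zero_add]
  linear_combination σ * hπ + π₁ * hσ

end ElementaryWaves

/-! ### Riemann solutions of one phase -/

/-- `v(x/t)` is a Riemann solution of the balance equations of one phase, with data `vL`, `vR`, for
a phase fraction which jumps from `αL` to `αR` at the speed `u₂`.  The wave of the `j`-th eigenvalue
has speed `σ j`. -/
structure IsPhaseRiemannSolution (E : EOS) (a αL αR : ℝ) (vL vR : PhaseState) (u₂ π₁ Q : ℝ)
    (σ : Fin 3 → ℝ) (v : ℝ → PhaseState) : Prop where
  admissible : ∀ ξ, (v ξ).Admissible E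
  eventually_eq : ∀ ξ, ξ ≠ u₂ → (∀ j, ξ ≠ σ j) → ∀ᶠ η in 𝓝 ξ, v η = v ξ
  eigenvalue_eq : ∀ j, ∀ᶠ η in 𝓝[≠] (σ j), (v η).eigenvalue a j = σ j
  left_state : ∀ ξ, ξ < vL.u - a * vL.τ → v ξ = vL
  right_state : ∀ ξ, vR.u + a * vR.τ < ξ → v ξ = vR
  equations : PhaseEquations E a u₂ π₁ Q (fun ξ => if ξ < u₂ then αL else αR) v

theorem isPhaseRiemannSolution_fan {E : EOS} {a αL αR u₂ π₁ Q : ℝ} {vL vR : PhaseState}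
    {σ : Fin 3 → ℝ} {l : List (ℝ × (ℝ × PhaseState))} (hsorted : SpeedsSorted l)
    (hfrac : ∀ ξ, (fan (αL, vL) l ξ).1 = if ξ < u₂ then αL else αR)
    (hlast : (((αL, vL) :: l.map Prod.snd).getLast (List.cons_ne_nil _ _)).2 = vR)
    (hL : vL.Admissible E) (hadm : ∀ p ∈ l, p.2.2.Admissible E)
    (hspeeds : ∀ p ∈ l, p.1 = u₂ ∨ ∃ j, p.1 = σ j)
    (hbounds : ∀ p ∈ l, vL.u - a * vL.τ ≤ p.1 ∧ p.1 ≤ vR.u + a * vR.τ)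
    (hmem : ∀ j, σ j ∈ l.map Prod.fst)
    (heig : ∀ j, ∀ i ∈ jumps (αL, vL) l, σ j = i.1 →
      i.2.1.2.eigenvalue a j = σ j ∧ i.2.2.2.eigenvalue a j = σ j)
    (hRH : ∀ i ∈ jumps (αL, vL) l, RankineHugoniot E a π₁ i.1 i.2.1 i.2.2)
    (hQ : ∀ δ : ℝ → ℝ, ((jumps (αL, vL) l).map fun i =>
      energyDefect E a u₂ π₁ i.1 i.2.1 i.2.2 * δ i.1).sum = -Q * δ u₂) :
    IsPhaseRiemannSolution E a αL αR vL vR u₂ π₁ Q σ fun ξ => (fan (αL, vL) l ξ).2 where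
  admissible := forall_fan (P := fun w : ℝ × PhaseState => w.2.Admissible E) hL hadm
  eventually_eq ξ hu hσ := by
    refine (eventually_fan_eq fun p hp hξ => ?_).mono fun η hη => congrArg Prod.snd hη
    rcases hspeeds p hp with hpu | ⟨j, hpj⟩
    · exact hu (hξ.trans hpu)
    · exact hσ j (hξ.trans hpj)
  eigenvalue_eq j :=
    eventually_nhdsNE_fan (P := fun w : ℝ × PhaseState => w.2.eigenvalue a j = σ j) hsorted
      (hmem j) (heig j)
  left_state ξ hξ :=
    congrArg Prod.snd (fan_of_forall_lt fun p hp => hξ.trans_le (hbounds p hp).1)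
  right_state ξ hξ := by
    rw [fan_of_forall_le fun p hp => (hbounds p hp).2.trans hξ.le, hlast]
  equations := by
    simpa only [hfrac] using phaseEquations_fan hsorted hRH hQ

/-- The phase state with specific volume `τ`, velocity `u`, and the entropy and relaxation
unknown of `v`. -/
def PhaseState.moved (v : PhaseState) (τ u : ℝ) : PhaseState := ⟨τ⁻¹, u, v.s, v.rel⟩

namespace PhaseState

variable {v : PhaseState} {τ : ℝ}

@[simp] theorem moved_u (u : ℝ) : (v.moved τ u).u = u := rfl
@[simp] theorem moved_ρ (u : ℝ) : (v.moved τ u).ρ = τ⁻¹ := rfl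
@[simp] theorem moved_τ (u : ℝ) : (v.moved τ u).τ = τ := inv_inv τ

@[simp]
theorem relPressure_moved (E : EOS) (a u : ℝ) :
    (v.moved τ u).relPressure E a = v.relPressure E a + a ^ 2 * (v.τ - τ) := by
  have h := relPressure_sub_of_eq (E := E) (a := a) (v := v) (v' := v.moved τ u) rfl rfl
  rw [moved_τ] at h
  linear_combination h

theorem Admissible.moved {E : EOS} (h : v.Admissible E) (hτ : 0 < τ) (u : ℝ) :
    (v.moved τ u).Admissible E :=
  ⟨inv_pos.2 hτ, h.2⟩

@[simp] theorem eigenvalue_zero (a : ℝ) : v.eigenvalue a 0 = v.u - a * v.τ := rfl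
@[simp] theorem eigenvalue_one (a : ℝ) : v.eigenvalue a 1 = v.u := rfl
@[simp] theorem eigenvalue_two (a : ℝ) : v.eigenvalue a 2 = v.u + a * v.τ := rfl

end PhaseState

/-! ### Waves of a phase moving with the phase fraction wave -/

theorem exists_isPhaseRiemannSolution_of_contact {E : EOS} {a αL αR x π₁ : ℝ}
    {vL vR : PhaseState} (ha : 0 < a) (hL : vL.Admissible E) (hR : vR.Admissible E)
    (hxL : vL.u - a * vL.τ < x) (hxR : x < vR.u + a * vR.τ)
    (hπ : αR * (vR.relPressure E a + a * (x - vR.u)) - αL * (vL.relPressure E a - a * (x - vL.u))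
      = π₁ * (αR - αL)) :
    ∃ v, IsPhaseRiemannSolution E a αL αR vL vR x π₁ 0
      ![vL.u - a * vL.τ, x, vR.u + a * vR.τ] v := by
  obtain ⟨τ₁, hτ₁⟩ : ∃ τ₁, a * τ₁ = a * vL.τ + (x - vL.u) := ⟨_, mul_div_cancel₀ _ ha.ne'⟩
  obtain ⟨τ₂, hτ₂⟩ : ∃ τ₂, a * τ₂ = a * vR.τ - (x - vR.u) := ⟨_, mul_div_cancel₀ _ ha.ne'⟩
  have hτ₁_pos : 0 < τ₁ := pos_of_mul_pos_right (hτ₁ ▸ by linarith) ha.le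
  have hτ₂_pos : 0 < τ₂ := pos_of_mul_pos_right (hτ₂ ▸ by linarith) ha.le
  have hleft : x - a * τ₁ = vL.u - a * vL.τ := by linear_combination -hτ₁
  have hright : x + a * τ₂ = vR.u + a * vR.τ := by linear_combination hτ₂
  obtain ⟨hRH₁, hE₁⟩ := acoustic_wave (E := E) (π₁ := π₁) (σ := vL.u - a * vL.τ) (α := αL)
    (u₂ := x) (v := vL) (v' := vL.moved τ₁ x) (ε := -1) ha.ne' (by norm_num) hL.1.ne'
    (hL.moved hτ₁_pos x).1.ne' rfl rfl (by ring)
    (by linear_combination (norm := (simp; ring)) hleft)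
  obtain ⟨hRH₂, hE₂⟩ := contact_wave (E := E) (a := a) (π₁ := π₁) (σ := x) (u₂ := x)
    (w := (αL, vL.moved τ₁ x)) (w' := (αR, vR.moved τ₂ x)) rfl rfl
    (by
      simp only [PhaseState.relPressure_moved]
      linear_combination hπ + a * (αL * hτ₁ - αR * hτ₂))
    (by simp)
  obtain ⟨hRH₃, hE₃⟩ := acoustic_wave (E := E) (π₁ := π₁) (σ := vR.u + a * vR.τ) (α := αR)
    (u₂ := x) (v := vR.moved τ₂ x) (v' := vR) (ε := 1) ha.ne' (by norm_num)
    (hR.moved hτ₂_pos x).1.ne' hR.1.ne' rfl rfl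
    (by linear_combination (norm := (simp; ring)) hright) (by ring)
  refine ⟨_, isPhaseRiemannSolution_fan (l := [(vL.u - a * vL.τ, (αL, vL.moved τ₁ x)),
    (x, (αR, vR.moved τ₂ x)), (vR.u + a * vR.τ, (αR, vR))]) ?_ ?_ rfl hL ?_ ?_ ?_ ?_ ?_ ?_ ?_⟩
  · simp [SpeedsSorted, hxL.le, hxR.le, (hxL.trans hxR).le, -tsub_le_iff_right]
  · intro ξ
    simp only [fan]
    grind
  · simp [hL.moved hτ₁_pos x, hR.moved hτ₂_pos x, hR]
  · simp [Fin.exists_fin_succ]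
  · simp [hxL.le, hxR.le, (hxL.trans hxR).le, -tsub_le_iff_right]
  · simp [Fin.forall_fin_succ]
  · simp [Fin.forall_fin_succ, jumps, hleft, hright, hxL.ne, hxL.ne', hxR.ne, hxR.ne',
      (hxL.trans hxR).ne, (hxL.trans hxR).ne']
  · simp [jumps, hRH₁, hRH₂, hRH₃]
  · simp [jumps, hE₁, hE₂, hE₃]

/-! ### Waves of a phase crossing the phase fraction wave -/

/-- The inequalities on the Mach numbers `M`, `N` of a phase on both sides of the phase fraction
wave and on the velocity difference `c = u♯ - u₂` which express that the flow through this wave is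
subsonic and rightward, that the three intermediate specific volumes are positive, and that the
energy is dissipated.  Here `A` and `B` stand for `a τ♯_L` and `a τ♯_R`. -/
structure IsAdmissibleMach (A B M N c : ℝ) : Prop where
  M_nonneg : 0 ≤ M
  M_lt_one : M < 1
  N_nonneg : 0 ≤ N
  neg_lt : -A < c
  lt : c < A
  contact : N * (A + c) < (B + c) * (1 + N)
  dissipation : (A - c) ^ 2 * ((1 + M) * (1 + N)) ≤ (A + c) ^ 2 * ((1 - M) * (1 - N))

namespace IsAdmissibleMach

variable {A B : ℝ}

theorem of_eq {M : ℝ} (hA : 0 < A) (hB : 0 < B) (hM₀ : 0 ≤ M) (hM₁ : M < 1) :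
    IsAdmissibleMach A B M M (M * A) where
  M_nonneg := hM₀
  M_lt_one := hM₁
  N_nonneg := hM₀
  neg_lt := by linarith [mul_nonneg hM₀ hA.le]
  lt := mul_lt_of_lt_one_left hA hM₁
  contact := by linear_combination mul_pos hB (by linarith : 0 < 1 + M)
  dissipation := le_of_eq (by ring)

/-- As `M → 0` the dissipation inequality becomes `(A - c₀)² ≤ (A + c₀)²`. -/
theorem eventually {c₀ : ℝ} (hB : 0 < B) (hc₀ : 0 < c₀) (hc₀A : c₀ < A) (k : ℝ) {ν : ℝ}
    (hν : 0 ≤ ν) : ∀ᶠ M in 𝓝[>] 0, IsAdmissibleMach A B M (ν * M) (c₀ + k * M) := by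
  have hA := hc₀.trans hc₀A
  have eventually_lt (f g : ℝ → ℝ) (hf : Continuous f) (hg : Continuous g) (h : f 0 < g 0) :
      ∀ᶠ M in 𝓝[>] 0, f M < g M :=
    (hf.continuousAt.eventually_lt hg.continuousAt h).filter_mono nhdsWithin_le_nhds
  filter_upwards [eventually_mem_nhdsWithin,
    eventually_lt (fun M => M) (fun _ => 1) (by fun_prop) (by fun_prop) one_pos,
    eventually_lt (fun _ => -A) (fun M => c₀ + k * M) (by fun_prop) (by fun_prop)
      (by linarith),
    eventually_lt (fun M => c₀ + k * M) (fun _ => A) (by fun_prop) (by fun_prop) (by simpa),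
    eventually_lt (fun M => ν * M * (A + (c₀ + k * M)))
      (fun M => (B + (c₀ + k * M)) * (1 + ν * M)) (by fun_prop) (by fun_prop)
      (by linarith),
    eventually_lt (fun M => (A - (c₀ + k * M)) ^ 2 * ((1 + M) * (1 + ν * M)))
      (fun M => (A + (c₀ + k * M)) ^ 2 * ((1 - M) * (1 - ν * M))) (by fun_prop) (by fun_prop)
      (by linear_combination 4 * mul_pos hA hc₀)]
    with M hM₀ hM₁ hneg_lt hlt hcontact hdissipation
  have hM₀ : 0 < M := hM₀
  exact ⟨hM₀.le, hM₁, by positivity, hneg_lt, hlt, hcontact, hdissipation.le⟩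

end IsAdmissibleMach

/-- The jump relations of a solution of one phase whose four waves are, from the left to the right,
`u - a τ`, the phase fraction wave of speed `u₂`, `u` and `u + a τ`.  The intermediate specific
volumes are `τ₁`, `τ₂`, `τ₃`, and `M`, `N` are the Mach numbers `(u - u₂) / (a τ)` on the left and
on the right of the phase fraction wave; the mass flux through it is `αL * M * a = αR * N * a`. -/
structure IsRightwardWaveFan (E : EOS) (a αL αR : ℝ) (vL vR : PhaseState)
    (u₂ π₁ M N τ₁ τ₂ τ₃ : ℝ) : Prop where
  τ₁_pos : 0 < τ₁
  τ₂_pos : 0 < τ₂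
  τ₃_pos : 0 < τ₃
  M_nonneg : 0 ≤ M
  M_lt_one : M < 1
  acoustic_left : u₂ + M * (a * τ₁) - a * τ₁ = vL.u - a * vL.τ
  acoustic_right : u₂ + N * (a * τ₂) + a * τ₃ = vR.u + a * vR.τ
  mass : αR * N = αL * M
  momentum : αL * M * a * (N * (a * τ₂) - M * (a * τ₁))
      + (αR * (vL.relPressure E a + a ^ 2 * (vL.τ - τ₂))
        - αL * (vL.relPressure E a + a ^ 2 * (vL.τ - τ₁))) = π₁ * (αR - αL)
  contact : vL.relPressure E a + a ^ 2 * (vL.τ - τ₂) = vR.relPressure E a + a ^ 2 * (vR.τ - τ₃)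

namespace IsRightwardWaveFan

variable {E : EOS} {a αL αR : ℝ} {vL vR : PhaseState} {u₂ π₁ M N τ₁ τ₂ τ₃ : ℝ}

theorem interface_wave (h : IsRightwardWaveFan E a αL αR vL vR u₂ π₁ M N τ₁ τ₂ τ₃) (ha : a ≠ 0) :
    RankineHugoniot E a π₁ u₂ (αL, vL.moved τ₁ (u₂ + M * (a * τ₁)))
        (αR, vL.moved τ₂ (u₂ + N * (a * τ₂))) ∧
      energyDefect E a u₂ π₁ u₂ (αL, vL.moved τ₁ (u₂ + M * (a * τ₁)))
        (αR, vL.moved τ₂ (u₂ + N * (a * τ₂)))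
        = -(αL * M * a / 2 * ((1 - N ^ 2) * (a * τ₂) ^ 2 - (1 - M ^ 2) * (a * τ₁) ^ 2)) := by
  have hτ₁ : τ₁⁻¹ * τ₁ = 1 := inv_mul_cancel₀ h.τ₁_pos.ne'
  have hτ₂ : τ₂⁻¹ * τ₂ = 1 := inv_mul_cancel₀ h.τ₂_pos.ne'
  have hjump : TransportedJump E a π₁ u₂ (αL, vL.moved τ₁ (u₂ + M * (a * τ₁)))
      (αR, vL.moved τ₂ (u₂ + N * (a * τ₂))) := by
    refine ⟨rfl, rfl, ?_, ?_⟩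
    · simp only [PhaseState.moved_ρ, PhaseState.moved_u]
      linear_combination αR * N * a * hτ₂ - αL * M * a * hτ₁ + a * h.mass
    · simp only [PhaseState.moved_ρ, PhaseState.moved_u, PhaseState.relPressure_moved]
      linear_combination h.momentum + αL * M * a * (N * (a * τ₂) - M * (a * τ₁)) * hτ₁
  refine ⟨hjump.rankineHugoniot, ?_⟩
  rw [hjump.energyDefect_eq ha (inv_pos.2 h.τ₁_pos).ne' (inv_pos.2 h.τ₂_pos).ne' (by simp)]
  simp only [PhaseState.moved_ρ, PhaseState.moved_u, PhaseState.moved_τ]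
  linear_combination αL * M * a / 2
    * ((N ^ 2 - 1) * (a * τ₂) ^ 2 - (M ^ 2 - 1) * (a * τ₁) ^ 2) * hτ₁

theorem le_contact_speed (h : IsRightwardWaveFan E a αL αR vL vR u₂ π₁ M N τ₁ τ₂ τ₃) (ha : 0 ≤ a)
    (hαL : 0 < αL) (hαR : 0 < αR) : u₂ ≤ u₂ + N * (a * τ₂) := by
  have hN : 0 ≤ N :=
    nonneg_of_mul_nonneg_right (h.mass ▸ mul_nonneg hαL.le h.M_nonneg) hαR
  exact le_add_of_nonneg_right (mul_nonneg hN (mul_nonneg ha h.τ₂_pos.le))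

theorem left_speed_lt (h : IsRightwardWaveFan E a αL αR vL vR u₂ π₁ M N τ₁ τ₂ τ₃) (ha : 0 < a) :
    vL.u - a * vL.τ < u₂ := by
  linarith [h.acoustic_left, mul_pos (sub_pos.2 h.M_lt_one) (mul_pos ha h.τ₁_pos)]

theorem lt_right_speed (h : IsRightwardWaveFan E a αL αR vL vR u₂ π₁ M N τ₁ τ₂ τ₃) (ha : 0 < a) :
    u₂ + N * (a * τ₂) < vR.u + a * vR.τ := by
  linarith [h.acoustic_right, mul_pos ha h.τ₃_pos]

theorem velocity_eq_of_speed_eq (h : IsRightwardWaveFan E a αL αR vL vR u₂ π₁ M N τ₁ τ₂ τ₃)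
    (ha : a ≠ 0) (hαL : αL ≠ 0) (heq : u₂ + N * (a * τ₂) = u₂) :
    M * (a * τ₁) = N * (a * τ₂) := by
  have hN : N = 0 := by simpa [ha, h.τ₂_pos.ne'] using heq
  have hM : M = 0 := by simpa [hN, hαL] using h.mass.symm
  rw [hM, hN, zero_mul, zero_mul]

theorem exists_isPhaseRiemannSolution (h : IsRightwardWaveFan E a αL αR vL vR u₂ π₁ M N τ₁ τ₂ τ₃)
    (ha : 0 < a) (hαL : 0 < αL) (hαR : 0 < αR) (hL : vL.Admissible E) (hR : vR.Admissible E) :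
    ∃ v, IsPhaseRiemannSolution E a αL αR vL vR u₂ π₁
      (αL * M * a / 2 * ((1 - N ^ 2) * (a * τ₂) ^ 2 - (1 - M ^ 2) * (a * τ₁) ^ 2))
      ![vL.u - a * vL.τ, u₂ + N * (a * τ₂), vR.u + a * vR.τ] v := by
  have hadm₁ := hL.moved h.τ₁_pos (u₂ + M * (a * τ₁))
  have hadm₂ := hL.moved h.τ₂_pos (u₂ + N * (a * τ₂))
  have hadm₃ := hR.moved h.τ₃_pos (u₂ + N * (a * τ₂))
  have hlt₁ := h.left_speed_lt ha
  have hle₂ := h.le_contact_speed ha.le hαL hαR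
  have hlt₃ := h.lt_right_speed ha
  have hlt₁₂ := hlt₁.trans_le hle₂
  have hlt₂₃ := hle₂.trans_lt hlt₃
  have hlt := hlt₁.trans hlt₂₃
  obtain ⟨hRH₁, hE₁⟩ := acoustic_wave (E := E) (π₁ := π₁) (σ := vL.u - a * vL.τ) (α := αL)
    (u₂ := u₂) (ε := -1) ha.ne' (by norm_num) hL.1.ne' hadm₁.1.ne' rfl rfl (by ring)
    (by linear_combination (norm := (simp; ring)) h.acoustic_left)
  obtain ⟨hRH₂, hE₂⟩ := h.interface_wave ha.ne'
  obtain ⟨hRH₃, hE₃⟩ := contact_wave (E := E) (a := a) (π₁ := π₁) (u₂ := u₂)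
    (σ := u₂ + N * (a * τ₂)) (w := (αR, vL.moved τ₂ (u₂ + N * (a * τ₂))))
    (w' := (αR, vR.moved τ₃ (u₂ + N * (a * τ₂)))) rfl rfl
    (by simp only [PhaseState.relPressure_moved]; linear_combination -αR * h.contact) (by simp)
  obtain ⟨hRH₄, hE₄⟩ := acoustic_wave (E := E) (π₁ := π₁) (σ := vR.u + a * vR.τ) (α := αR)
    (u₂ := u₂) (ε := 1) ha.ne' (by norm_num) hadm₃.1.ne' hR.1.ne' rfl rfl
    (by linear_combination (norm := (simp; ring)) h.acoustic_right) (by ring)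
  refine ⟨_, isPhaseRiemannSolution_fan (l := [
    (vL.u - a * vL.τ, (αL, vL.moved τ₁ (u₂ + M * (a * τ₁)))),
    (u₂, (αR, vL.moved τ₂ (u₂ + N * (a * τ₂)))),
    (u₂ + N * (a * τ₂), (αR, vR.moved τ₃ (u₂ + N * (a * τ₂)))),
    (vR.u + a * vR.τ, (αR, vR))]) ?_ ?_ rfl hL ?_ ?_ ?_ ?_ ?_ ?_ ?_⟩
  · simp [SpeedsSorted, hlt₁.le, hle₂, hlt₃.le, hlt₁₂.le, hlt₂₃.le, hlt.le, -tsub_le_iff_right,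
      -le_add_iff_nonneg_right]
  · intro ξ
    simp only [fan]
    grind
  · simp [hadm₁, hadm₂, hadm₃, hR]
  · simp [Fin.exists_fin_succ]
  · simp [hlt₁.le, hlt₃.le, hlt₁₂.le, hlt₂₃.le, hlt.le, -tsub_le_iff_right]
  · simp [Fin.forall_fin_succ]
  · simpa [Fin.forall_fin_succ, jumps, h.acoustic_left, h.acoustic_right, hlt₁.ne, hlt₁₂.ne,
      hlt₁₂.ne', hlt.ne, hlt.ne', hlt₂₃.ne', hlt₃.ne, hlt₃.ne', -add_eq_left]
      using h.velocity_eq_of_speed_eq ha.ne' hαL.ne'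
  · simp [jumps, hRH₁, hRH₂, hRH₃, hRH₄]
  · simp [jumps, hE₁, hE₂, hE₃, hE₄]

theorem dissipation_nonneg (h : IsRightwardWaveFan E a αL αR vL vR u₂ π₁ M N τ₁ τ₂ τ₃)
    (ha : 0 ≤ a) (hαL : 0 ≤ αL) {A B c : ℝ} (hMach : IsAdmissibleMach A B M N c)
    (hτ₁ : (1 - M) * (a * τ₁) = A - c) (hτ₂ : (1 + N) * (a * τ₂) = A + c) :
    0 ≤ αL * M * a / 2 * ((1 - N ^ 2) * (a * τ₂) ^ 2 - (1 - M ^ 2) * (a * τ₁) ^ 2) := by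
  have hM := h.M_nonneg
  refine mul_nonneg (by positivity) ?_
  have hfactor : 0 < (1 - M) * (1 + N) :=
    mul_pos (sub_pos.2 h.M_lt_one) (by linarith [hMach.N_nonneg])
  refine nonneg_of_mul_nonneg_right ?_ hfactor
  calc 0 ≤ (A + c) ^ 2 * ((1 - M) * (1 - N)) - (A - c) ^ 2 * ((1 + M) * (1 + N)) :=
        sub_nonneg.2 hMach.dissipation
    _ = _ := by rw [← hτ₁, ← hτ₂]; ring

variable {u π₀ A B c : ℝ}

/-- The data enter through the quantities `u♯`, `π♯`, `a τ♯_L`, `a τ♯_R`, called `u`, `π₀`, `A`,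
`B`, and the velocity difference `c = u♯ - u₂`. -/
theorem exists_of_mach (ha : 0 < a) (hπL : vL.relPressure E a = π₀ + a * (u - vL.u))
    (hπR : vR.relPressure E a = π₀ - a * (u - vR.u)) (hA : a * vL.τ + (u - vL.u) = A)
    (hB : a * vR.τ - (u - vR.u) = B) (hMach : IsAdmissibleMach A B M N c)
    (hmass : αR * N = αL * M)
    (hmomentum : (αR - αL) * (π₁ - π₀) = a * (2 * αL * M * A - (αR + αL) * c)) :
    ∃ τ₁ τ₂ τ₃, IsRightwardWaveFan E a αL αR vL vR (u - c) π₁ M N τ₁ τ₂ τ₃ ∧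
      (1 - M) * (a * τ₁) = A - c ∧ (1 + N) * (a * τ₂) = A + c := by
  obtain ⟨hM₀, hM₁, hN₀, hAc, hcA, hcB, -⟩ := hMach
  have hM : 0 < 1 - M := sub_pos.2 hM₁
  have hN₁ : 0 < 1 + N := by linarith
  have haM := mul_pos hM ha
  have haN := mul_pos hN₁ ha
  have hτ₁ : (1 - M) * (a * ((A - c) / ((1 - M) * a))) = A - c := by
    rw [← mul_assoc, mul_div_cancel₀ _ haM.ne']
  have hτ₂ : (1 + N) * (a * ((A + c) / ((1 + N) * a))) = A + c := by
    rw [← mul_assoc, mul_div_cancel₀ _ haN.ne']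
  have hτ₁_pos : 0 < (A - c) / ((1 - M) * a) := div_pos (by linarith) haM
  have hτ₂_pos : 0 < (A + c) / ((1 + N) * a) := div_pos (by linarith) haN
  generalize (A - c) / ((1 - M) * a) = τ₁ at hτ₁ hτ₁_pos
  generalize (A + c) / ((1 + N) * a) = τ₂ at hτ₂ hτ₂_pos
  have hτ₃ : a * ((B + c - N * (a * τ₂)) / a) = B + c - N * (a * τ₂) := mul_div_cancel₀ _ ha.ne'
  have hτ₃_pos : 0 < (B + c - N * (a * τ₂)) / a := by
    refine div_pos (pos_of_mul_pos_left ?_ hN₁.le) ha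
    linear_combination hcB + N * hτ₂
  generalize (B + c - N * (a * τ₂)) / a = τ₃ at hτ₃ hτ₃_pos
  refine ⟨τ₁, τ₂, τ₃, ⟨hτ₁_pos, hτ₂_pos, hτ₃_pos, hM₀, hM₁, ?_, ?_, hmass, ?_, ?_⟩, hτ₁, hτ₂⟩
  · linear_combination hA - hτ₁
  · linear_combination -hB + hτ₃
  · linear_combination -hmomentum + (αR - αL) * hπL + a * (αR - αL) * hA
      + a * αL * (1 + M) * hτ₁ + a * αR * (N - 1) * hτ₂ + a * (A + c - N * (a * τ₂)) * hmass
  · linear_combination hπL - hπR + a * hA - a * hB + a * hτ₃ - a * hτ₂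

end IsRightwardWaveFan

/-! ### Existence of coupled phase 1 solutions -/

/-- The coupled interface conditions are affine in the Mach number: in the absence of mass transfer,
`c = (K + a |αR - αL|) / (K + a (αR + αL)) * U`. Here `K` stands for `a₂ (α_{2,R} + α_{2,L})`. -/
theorem exists_isAdmissibleMach {a K αL αR A B U : ℝ} (ha : 0 < a) (hK : 0 < K) (hαL : 0 < αL)
    (hαR : 0 < αR) (hB : 0 < B) (hU₀ : 0 ≤ U) (hUA : U < A) :
    ∃ M N c, IsAdmissibleMach A B M N c ∧ αR * N = αL * M ∧
      (K + a * (αR + αL)) * c = (K + a * |αR - αL|) * U + 2 * a * αL * M * A ∧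
      (αR = αL → c = M * A) := by
  have hA : 0 < A := hU₀.trans_lt hUA
  have hD : 0 < K + a * (αR + αL) := by positivity
  by_cases heq : αR = αL
  · refine ⟨U / A, U / A, U / A * A, .of_eq hA hB (by positivity) ((div_lt_one hA).2 hUA),
      by rw [heq], ?_, fun _ => rfl⟩
    rw [heq, sub_self, abs_zero]
    linear_combination K * div_mul_cancel₀ U hA.ne'
  rcases hU₀.eq_or_lt with rfl | hU
  · exact ⟨0, 0, 0 * A, .of_eq hA hB le_rfl one_pos, by simp, by simp, fun _ => rfl⟩
  set c₀ := (K + a * |αR - αL|) * U / (K + a * (αR + αL)) with hc₀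
  have hle : |αR - αL| ≤ αR + αL := abs_le.2 ⟨by linarith, by linarith⟩
  have hc₀U : c₀ ≤ U := by
    rw [hc₀, div_le_iff₀ hD, mul_comm U]
    gcongr
  obtain ⟨M, hM⟩ := (IsAdmissibleMach.eventually hB (by positivity) (hc₀U.trans_lt hUA)
    (2 * a * αL * A / (K + a * (αR + αL))) (div_pos hαL hαR).le).exists
  exact ⟨M, _, _, hM, by field_simp, by rw [hc₀]; field_simp, fun h => absurd h heq⟩

theorem State.Admissible.frac_pos {E : Fin 2 → EOS} {W : State} (h : W.Admissible E)
    (k : Fin 2) : 0 < W.frac k := by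
  fin_cases k
  · exact h.1
  · exact sub_pos.2 h.2.1

section

variable {E : Fin 2 → EOS} {a : Fin 2 → ℝ} {WL WR : State}

theorem relPressure_left_eq {k : Fin 2} (ha : a k ≠ 0) :
    (WL.phase k).relPressure (E k) (a k)
      = piSharp E a WL WR k + a k * (uSharp E a WL WR k - (WL.phase k).u) := by
  simp only [piSharp, uSharp]
  field_simp
  ring

theorem relPressure_right_eq {k : Fin 2} (ha : a k ≠ 0) :
    (WR.phase k).relPressure (E k) (a k)
      = piSharp E a WL WR k - a k * (uSharp E a WL WR k - (WR.phase k).u) := by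
  simp only [piSharp, uSharp]
  field_simp
  ring

theorem mul_tauSharpL {k : Fin 2} (ha : a k ≠ 0) :
    a k * tauSharpL E a WL WR k
      = a k * (WL.phase k).τ + (uSharp E a WL WR k - (WL.phase k).u) := by
  rw [tauSharpL]
  field_simp

theorem mul_tauSharpR {k : Fin 2} (ha : a k ≠ 0) :
    a k * tauSharpR E a WL WR k
      = a k * (WR.phase k).τ - (uSharp E a WL WR k - (WR.phase k).u) := by
  rw [tauSharpR]
  field_simp

theorem State.frac_one (W : State) : W.frac 1 = 1 - W.frac 0 := rfl

theorem mul_USharp (ha : ∀ k, 0 < a k) (hfrac : 0 < WR.frac 1 + WL.frac 1) :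
    (a 1 * (WR.frac 1 + WL.frac 1) + a 0 * |WR.frac 0 - WL.frac 0|) * USharp E a WL WR
      = a 1 * (WR.frac 1 + WL.frac 1) * (uSharp E a WL WR 0 - uSharp E a WL WR 1)
        + (WR.frac 0 - WL.frac 0) * (piSharp E a WL WR 0 - piSharp E a WL WR 1) := by
  have h₀ := ha 0
  have h₁ := ha 1
  have hΔ : WR.frac 1 - WL.frac 1 = -(WR.frac 0 - WL.frac 0) := by
    rw [State.frac_one, State.frac_one]; ring
  have habs := abs_nonneg (WR.frac 0 - WL.frac 0)
  rw [USharp, lambdaAlpha, abs_div, hΔ, abs_neg, abs_of_pos hfrac]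
  generalize |WR.frac 0 - WL.frac 0| = d at *
  have hden : 1 + a 0 / a 1 * (d / (WR.frac 1 + WL.frac 1))
      = (a 1 * (WR.frac 1 + WL.frac 1) + a 0 * d) / (a 1 * (WR.frac 1 + WL.frac 1)) := by
    field_simp
  have hne : a 1 * (WR.frac 1 + WL.frac 1) + a 0 * d ≠ 0 := by positivity
  rw [hden]
  field_simp
  ring

theorem IsPhaseRiemannSolution.isPhaseOneSolution {v : ℝ → PhaseState} {u₂ π₁ Q : ℝ}
    {σ : Fin 3 → ℝ} (h : IsPhaseRiemannSolution (E 0) (a 0) (WL.frac 0) (WR.frac 0) (WL.phase 0)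
      (WR.phase 0) u₂ π₁ Q σ v)
    (hcoupling : (WR.frac 0 - WL.frac 0) * π₁ = (WR.frac 0 - WL.frac 0) * piSharp E a WL WR 1
      - a 1 * (WR.frac 1 + WL.frac 1) * (u₂ - uSharp E a WL WR 1)) (hQ : 0 ≤ Q)
    (hleft : (WL.phase 0).u - a 0 * (WL.phase 0).τ < u₂)
    (hright : u₂ < (WR.phase 0).u + a 0 * (WR.phase 0).τ) :
    IsPhaseOneSolution E a WL WR v u₂ π₁ Q :=
  ⟨h.admissible, ⟨σ, h.eventually_eq, h.eigenvalue_eq⟩, h.left_state, h.right_state, h.equations,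
    hcoupling, hQ, hleft, hright⟩

theorem exists_mul_eq {Δ F : ℝ} (hF : Δ = 0 → F = 0) : ∃ p, Δ * p = F := by
  rcases eq_or_ne Δ 0 with rfl | hΔ
  · exact ⟨0, by rw [hF rfl, mul_zero]⟩
  · exact ⟨F / Δ, mul_div_cancel₀ F hΔ⟩

theorem exists_isPhaseOneSolution_of_USharp_nonneg (ha : ∀ k, 0 < a k) (hL : WL.Admissible E)
    (hR : WR.Admissible E) (hτR : 0 < tauSharpR E a WL WR 0)
    (hU : 0 ≤ USharp E a WL WR) (hUA : USharp E a WL WR < a 0 * tauSharpL E a WL WR 0) :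
    ∃ (u₂ π₁ Q : ℝ) (v : ℝ → PhaseState), IsPhaseOneSolution E a WL WR v u₂ π₁ Q := by
  have ha₀ := ha 0
  have hfrac : 0 < WR.frac 1 + WL.frac 1 := add_pos (hR.frac_pos 1) (hL.frac_pos 1)
  obtain ⟨M, N, c, hMach, hmass, hbalance, heq⟩ := exists_isAdmissibleMach ha₀
    (mul_pos (ha 1) hfrac) (hL.frac_pos 0) (hR.frac_pos 0) (mul_pos ha₀ hτR) hU hUA
  rw [mul_USharp ha hfrac] at hbalance
  -- If the phase fraction does not jump, the interface pressure is arbitrary.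
  obtain ⟨p, hmomentum⟩ : ∃ p, (WR.frac 0 - WL.frac 0) * p
      = a 0 * (2 * WL.frac 0 * M * (a 0 * tauSharpL E a WL WR 0)
        - (WR.frac 0 + WL.frac 0) * c) :=
    exists_mul_eq fun hΔ => by rw [heq (sub_eq_zero.1 hΔ), sub_eq_zero.1 hΔ]; ring
  obtain ⟨τ₁, τ₂, τ₃, hfan, hτ₁, hτ₂⟩ := IsRightwardWaveFan.exists_of_mach
    (π₁ := piSharp E a WL WR 0 + p) ha₀ (relPressure_left_eq (WR := WR) ha₀.ne')
    (relPressure_right_eq (WL := WL) ha₀.ne') (mul_tauSharpL ha₀.ne').symm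
    (mul_tauSharpR ha₀.ne').symm hMach hmass (by linear_combination hmomentum)
  obtain ⟨v, hv⟩ := hfan.exists_isPhaseRiemannSolution ha₀ (hL.frac_pos 0) (hR.frac_pos 0)
    (hL.2.2 0) (hR.2.2 0)
  exact ⟨_, _, _, v, hv.isPhaseOneSolution (by linear_combination hmomentum - hbalance)
    (hfan.dissipation_nonneg ha₀.le (hL.frac_pos 0).le hMach hτ₁ hτ₂) (hfan.left_speed_lt ha₀)
    ((hfan.le_contact_speed ha₀.le (hL.frac_pos 0) (hR.frac_pos 0)).trans_lt
      (hfan.lt_right_speed ha₀))⟩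

end

/-! ### Mirror symmetry -/

/-- The state seen after the reflection `x ↦ -x`. -/
def PhaseState.mirror (v : PhaseState) : PhaseState := ⟨v.ρ, -v.u, v.s, v.rel⟩

namespace PhaseState

variable {E : EOS} {a : ℝ} (v : PhaseState)

@[simp] theorem mirror_ρ : v.mirror.ρ = v.ρ := rfl
@[simp] theorem mirror_u : v.mirror.u = -v.u := rfl
@[simp] theorem mirror_s : v.mirror.s = v.s := rfl
@[simp] theorem mirror_rel : v.mirror.rel = v.rel := rfl
@[simp] theorem mirror_τ : v.mirror.τ = v.τ := rfl
@[simp] theorem mirror_mirror : v.mirror.mirror = v := by simp [mirror]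
@[simp] theorem relPressure_mirror : v.mirror.relPressure E a = v.relPressure E a := rfl

@[simp]
theorem relEnergy_mirror : v.mirror.relEnergy E a = v.relEnergy E a := by
  simp [relEnergy]

variable {v} in
theorem Admissible.mirror (h : v.Admissible E) : v.mirror.Admissible E := h

theorem eigenvalue_mirror (j : Fin 3) :
    v.mirror.eigenvalue a j = -v.eigenvalue a (Fin.rev j) := by
  fin_cases j <;> simp [eigenvalue] <;> ring

end PhaseState

theorem PhaseEquations.congr_frac {E : EOS} {a u₂ π₁ Q c : ℝ} {α α' : ℝ → ℝ} {v : ℝ → PhaseState}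
    (h : PhaseEquations E a u₂ π₁ Q α v) (hα : ∀ ξ ≠ c, α ξ = α' ξ) :
    PhaseEquations E a u₂ π₁ Q α' v := by
  have hDt (g : ℝ → ℝ) (φ) :
      distDt (fun ξ => α ξ * g ξ) φ = distDt (fun ξ => α' ξ * g ξ) φ :=
    distDt_congr (fun ξ hξ => by rw [hα ξ hξ]) φ
  have hDx (g : ℝ → ℝ) (φ) :
      distDx (fun ξ => α ξ * g ξ) φ = distDx (fun ξ => α' ξ * g ξ) φ :=
    distDx_congr (fun ξ hξ => by rw [hα ξ hξ]) φ
  obtain ⟨hmass, hmomentum, hentropy, hrel, henergy⟩ := h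
  simp only [mul_assoc, ← mul_add, hDt, hDx, distDx_congr hα]
    at hmass hmomentum hentropy hrel henergy
  constructor <;> simpa only [mul_assoc, ← mul_add]

theorem PhaseEquations.mirror {E : EOS} {a u₂ π₁ Q : ℝ} {α : ℝ → ℝ} {v : ℝ → PhaseState}
    (h : PhaseEquations E a u₂ π₁ Q α v) :
    PhaseEquations E a (-u₂) π₁ Q (fun ξ => α (-ξ)) (fun ξ => (v (-ξ)).mirror) := by
  constructor <;> intro φ hφ <;>
    simp only [PhaseState.mirror_ρ, PhaseState.mirror_u, PhaseState.mirror_s,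
      PhaseState.mirror_rel, PhaseState.relPressure_mirror, PhaseState.relEnergy_mirror, mul_neg,
      neg_sq, ← neg_add, distDt_neg, distDx_neg]
  · rw [distDt_comp_neg (fun ξ => α ξ * (v ξ).ρ),
      distDx_comp_neg (fun ξ => α ξ * (v ξ).ρ * (v ξ).u)]
    linear_combination h.mass _ hφ.comp_reflection
  · rw [distDt_comp_neg (fun ξ => α ξ * (v ξ).ρ * (v ξ).u),
      distDx_comp_neg (fun ξ => α ξ * (v ξ).ρ * (v ξ).u ^ 2 + α ξ * (v ξ).relPressure E a),
      distDx_comp_neg α]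
    linear_combination -h.momentum _ hφ.comp_reflection
  · rw [distDt_comp_neg (fun ξ => α ξ * (v ξ).ρ * (v ξ).s),
      distDx_comp_neg (fun ξ => α ξ * (v ξ).ρ * (v ξ).s * (v ξ).u)]
    linear_combination h.entropy _ hφ.comp_reflection
  · rw [distDt_comp_neg (fun ξ => α ξ * (v ξ).ρ * (v ξ).rel),
      distDx_comp_neg (fun ξ => α ξ * (v ξ).ρ * (v ξ).rel * (v ξ).u)]
    linear_combination h.rel _ hφ.comp_reflection
  · rw [distDt_comp_neg (fun ξ => α ξ * (v ξ).ρ * (v ξ).relEnergy E a),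
      distDx_comp_neg (fun ξ => α ξ * (v ξ).ρ * (v ξ).relEnergy E a * (v ξ).u
        + α ξ * (v ξ).relPressure E a * (v ξ).u),
      distDx_comp_neg α, dirac_neg]
    linear_combination h.energy _ hφ.comp_reflection

/-- The state seen after the reflection `x ↦ -x`. -/
def State.mirror (W : State) : State := ⟨W.α₁, fun k => (W.phase k).mirror⟩

theorem State.Admissible.mirror {E : Fin 2 → EOS} {W : State} (h : W.Admissible E) :
    W.mirror.Admissible E :=
  ⟨h.1, h.2.1, fun k => (h.2.2 k).mirror⟩

section

variable {E : Fin 2 → EOS} {a : Fin 2 → ℝ} (W WL WR : State)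

@[simp]
theorem State.mirror_mirror : W.mirror.mirror = W := by
  simp [State.mirror]

@[simp] theorem State.frac_mirror (k : Fin 2) : W.mirror.frac k = W.frac k := rfl
@[simp] theorem State.phase_mirror (k : Fin 2) : W.mirror.phase k = (W.phase k).mirror := rfl

@[simp]
theorem uSharp_mirror (k : Fin 2) :
    uSharp E a WR.mirror WL.mirror k = -uSharp E a WL WR k := by
  simp only [uSharp, State.phase_mirror, PhaseState.mirror_u, PhaseState.relPressure_mirror]
  ring

@[simp]
theorem piSharp_mirror (k : Fin 2) :
    piSharp E a WR.mirror WL.mirror k = piSharp E a WL WR k := by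
  simp only [piSharp, State.phase_mirror, PhaseState.mirror_u, PhaseState.relPressure_mirror]
  ring

@[simp]
theorem tauSharpL_mirror (k : Fin 2) :
    tauSharpL E a WR.mirror WL.mirror k = tauSharpR E a WL WR k := by
  simp only [tauSharpL, tauSharpR, uSharp_mirror, State.phase_mirror, PhaseState.mirror_u,
    PhaseState.mirror_τ]
  ring

@[simp]
theorem tauSharpR_mirror (k : Fin 2) :
    tauSharpR E a WR.mirror WL.mirror k = tauSharpL E a WL WR k := by
  simp only [tauSharpL, tauSharpR, uSharp_mirror, State.phase_mirror, PhaseState.mirror_u,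
    PhaseState.mirror_τ]
  ring

@[simp]
theorem lambdaAlpha_mirror : lambdaAlpha WR.mirror WL.mirror = -lambdaAlpha WL WR := by
  simp only [lambdaAlpha, State.frac_mirror]
  ring

@[simp]
theorem USharp_mirror : USharp E a WR.mirror WL.mirror = -USharp E a WL WR := by
  simp only [USharp, uSharp_mirror, piSharp_mirror, lambdaAlpha_mirror, abs_neg]
  ring

variable {WL WR}

theorem IsPhaseOneSolution.mirror {v : ℝ → PhaseState} {u₂ π₁ Q : ℝ}
    (h : IsPhaseOneSolution E a WL WR v u₂ π₁ Q) :
    IsPhaseOneSolution E a WR.mirror WL.mirror (fun ξ => (v (-ξ)).mirror) (-u₂) π₁ Q where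
  admissible ξ := (h.admissible (-ξ)).mirror
  contacts := by
    obtain ⟨σ, hconst, heig⟩ := h.contacts
    refine ⟨fun j => -σ (Fin.rev j), fun ξ hξ hσ => ?_, fun j => ?_⟩
    · have hev := hconst (-ξ) (fun h => hξ (neg_eq_iff_eq_neg.1 h))
        fun j h => hσ (Fin.rev j) (by simpa using neg_eq_iff_eq_neg.1 h)
      filter_upwards [continuous_neg.continuousAt.eventually hev] with η hη
      rw [hη]
    · have hneg : Tendsto (fun η : ℝ => -η) (𝓝[≠] (-σ (Fin.rev j))) (𝓝[≠] (σ (Fin.rev j))) := by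
        simp [Tendsto]
      filter_upwards [hneg.eventually (heig (Fin.rev j))] with η hη
      rw [PhaseState.eigenvalue_mirror, hη]
  left_state ξ hξ := by
    rw [h.right_state (-ξ) (lt_neg.1 (by simpa [sub_eq_add_neg, add_comm] using hξ))]
    rfl
  right_state ξ hξ := by
    rw [h.left_state (-ξ) (neg_lt.1 (by simpa [sub_eq_add_neg, add_comm] using hξ))]
    rfl
  equations := h.equations.mirror.congr_frac (c := -u₂) fun ξ hξ => by
    simp only [State.frac_mirror]
    grind
  coupling := by
    simp only [State.frac_mirror, piSharp_mirror, uSharp_mirror]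
    linear_combination -h.coupling
  dissipation := h.dissipation
  subsonic_left := by
    simpa [sub_eq_add_neg, add_comm] using neg_lt_neg h.subsonic_right
  subsonic_right := by
    simpa [sub_eq_add_neg, add_comm] using neg_lt_neg h.subsonic_left

theorem exists_isPhaseOneSolution (ha : ∀ k, 0 < a k) (hL : WL.Admissible E)
    (hR : WR.Admissible E) (hτL : 0 < tauSharpL E a WL WR 0) (hτR : 0 < tauSharpR E a WL WR 0)
    (hA : ConditionA E a WL WR) :
    ∃ (u₂ π₁ Q : ℝ) (v : ℝ → PhaseState), IsPhaseOneSolution E a WL WR v u₂ π₁ Q := by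
  rcases le_total 0 (USharp E a WL WR) with hU | hU
  · exact exists_isPhaseOneSolution_of_USharp_nonneg ha hL hR hτR hU hA.2
  · obtain ⟨u₂, π₁, Q, v, h⟩ := exists_isPhaseOneSolution_of_USharp_nonneg ha hR.mirror hL.mirror
      (by simpa using hτL) (by simpa using hU)
      (by simpa using neg_lt.1 hA.1)
    exact ⟨_, _, _, _, by simpa using h.mirror⟩

end

/-! ### Superposition of the two phases -/

/-- The fields of the relaxation system made of the phase fraction wave of speed `u₂` and of the
phase states `v₁`, `v₂`. -/
def superpose (WL WR : State) (u₂ : ℝ) (v₁ v₂ : ℝ → PhaseState) (ξ : ℝ) : State :=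
  ⟨if ξ < u₂ then WL.α₁ else WR.α₁, ![v₁ ξ, v₂ ξ]⟩

section

variable {E : Fin 2 → EOS} {a : Fin 2 → ℝ} {WL WR : State} {v₁ v₂ : ℝ → PhaseState} {u₂ ξ : ℝ}

theorem frac_superpose (k : Fin 2) :
    (superpose WL WR u₂ v₁ v₂ ξ).frac k = fan (WL.frac k) [(u₂, WR.frac k)] ξ := by
  fin_cases k <;> simp only [superpose, State.frac, fan] <;> split_ifs <;> rfl

theorem distDt_frac_superpose {φ : ℝ × ℝ → ℝ} (hφ : IsTest φ) (k : Fin 2) :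
    distDt (fun ξ => (superpose WL WR u₂ v₁ v₂ ξ).frac k) φ
      = -u₂ * ((WR.frac k - WL.frac k) * dirac u₂ φ) := by
  have h := distDt_fan (w := WL.frac k) hφ id (List.pairwise_singleton _ (u₂, WR.frac k))
  simp only [id, jumps, List.map_cons, List.map_nil, List.sum_singleton] at h
  simp only [frac_superpose, h]
  ring

theorem distDx_frac_superpose {φ : ℝ × ℝ → ℝ} (hφ : IsTest φ) (k : Fin 2) :
    distDx (fun ξ => (superpose WL WR u₂ v₁ v₂ ξ).frac k) φ
      = (WR.frac k - WL.frac k) * dirac u₂ φ := by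
  have h := distDx_fan (w := WL.frac k) hφ id (List.pairwise_singleton _ (u₂, WR.frac k))
  simp only [id, jumps, List.map_cons, List.map_nil, List.sum_singleton] at h
  simp only [frac_superpose, h]

theorem superpose_eq_left (hξ : ξ < u₂) (h₁ : v₁ ξ = WL.phase 0) (h₂ : v₂ ξ = WL.phase 1) :
    superpose WL WR u₂ v₁ v₂ ξ = WL := by
  have hphase : ![WL.phase 0, WL.phase 1] = WL.phase := List.ofFn_inj.1 rfl
  rw [superpose, if_pos hξ, h₁, h₂, hphase]

theorem superpose_eq_right (hξ : u₂ ≤ ξ) (h₁ : v₁ ξ = WR.phase 0) (h₂ : v₂ ξ = WR.phase 1) :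
    superpose WL WR u₂ v₁ v₂ ξ = WR := by
  have hphase : ![WR.phase 0, WR.phase 1] = WR.phase := List.ofFn_inj.1 rfl
  rw [superpose, if_neg hξ.not_gt, h₁, h₂, hphase]

theorem IsPhaseOneSolution.isSubsonicSolution_superpose {π₁ Q : ℝ} {σ₂ : Fin 3 → ℝ}
    (hL : WL.Admissible E) (hR : WR.Admissible E)
    (h₁ : IsPhaseOneSolution E a WL WR v₁ u₂ π₁ Q)
    (h₂ : IsPhaseRiemannSolution (E 1) (a 1) (WL.frac 1) (WR.frac 1) (WL.phase 1) (WR.phase 1)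
      u₂ π₁ 0 σ₂ v₂) (hσ₂ : σ₂ 1 = u₂) :
    IsSubsonicSolution E a WL WR (superpose WL WR u₂ v₁ v₂) u₂ π₁ Q where
  admissible ξ := by
    refine ⟨?_, ?_, Fin.forall_fin_two.2 ⟨h₁.admissible ξ, h₂.admissible ξ⟩⟩ <;>
      simp only [superpose] <;> split_ifs
    exacts [hL.1, hR.1, hL.2.1, hR.2.1]
  contacts := by
    obtain ⟨σ₁, hconst₁, heig₁⟩ := h₁.contacts
    refine ⟨![σ₁, σ₂], hσ₂, fun ξ hξ => ?_, Fin.forall_fin_two.2 ⟨heig₁, h₂.eigenvalue_eq⟩⟩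
    obtain ⟨hξ₁, hξ₂⟩ := Fin.forall_fin_two.1 hξ
    have hu : ξ ≠ u₂ := hσ₂ ▸ hξ₂ 1
    have hα : ∀ᶠ η in 𝓝 ξ, fan WL.α₁ [(u₂, WR.α₁)] η = fan WL.α₁ [(u₂, WR.α₁)] ξ :=
      eventually_fan_eq (by simpa)
    filter_upwards [hα, hconst₁ ξ hu hξ₁, h₂.eventually_eq ξ hu hξ₂] with η hα hv₁ hv₂
    simp only [fan] at hα
    simp only [superpose, hα, hv₁, hv₂]
  left_state ξ hξ := superpose_eq_left ((hξ 0).trans h₁.subsonic_left)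
    (h₁.left_state ξ (hξ 0)) (h₂.left_state ξ (hξ 1))
  right_state ξ hξ := superpose_eq_right (h₁.subsonic_right.trans (hξ 0)).le
    (h₁.right_state ξ (hξ 0)) (h₂.right_state ξ (hξ 1))
  fraction k φ hφ := by
    rw [distDt_frac_superpose hφ, distDx_frac_superpose hφ]
    ring
  fraction_dirac k φ hφ := distDx_frac_superpose hφ k
  equations_one := by
    simp only [frac_superpose]
    exact h₁.equations
  equations_two := by
    simp only [frac_superpose]
    exact h₂.equations
  dissipation := h₁.dissipation
  subsonic_left := h₁.subsonic_left
  subsonic_right := h₁.subsonic_right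

theorem IsPhaseOneSolution.exists_isSubsonicSolution {π₁ Q : ℝ} (ha : 0 < a 1)
    (hL : WL.Admissible E) (hR : WR.Admissible E) (h : IsPhaseOneSolution E a WL WR v₁ u₂ π₁ Q)
    (hB : ConditionB E a WL WR u₂) :
    ∃ W, IsSubsonicSolution E a WL WR W u₂ π₁ Q ∧ ∀ ξ, (W ξ).phase 0 = v₁ ξ := by
  have hleft : (WL.phase 1).u - a 1 * (WL.phase 1).τ < u₂ := by
    linear_combination hB.1 + mul_tauSharpL (E := E) (WL := WL) (WR := WR) ha.ne'
  have hright : u₂ < (WR.phase 1).u + a 1 * (WR.phase 1).τ := by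
    linear_combination hB.2 + mul_tauSharpR (E := E) (WL := WL) (WR := WR) ha.ne'
  obtain ⟨v₂, h₂⟩ := exists_isPhaseRiemannSolution_of_contact (αL := WL.frac 1) (αR := WR.frac 1)
    (π₁ := π₁) ha (hL.2.2 1) (hR.2.2 1) hleft hright (by
      rw [relPressure_left_eq (WL := WL) (WR := WR) ha.ne',
        relPressure_right_eq (WL := WL) (WR := WR) ha.ne', State.frac_one, State.frac_one]
      have hcoupling := h.coupling
      rw [State.frac_one, State.frac_one] at hcoupling
      linear_combination hcoupling)
  exact ⟨_, h.isSubsonicSolution_superpose hL hR h₂ rfl, fun _ => rfl⟩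

end

end BaerNunziato

end

theorem mainTheorem3_general (E : Fin 2 → BaerNunziato.EOS) (a : Fin 2 → ℝ)
    (WL WR : BaerNunziato.State)
    (ha : ∀ k, 0 < a k)
    (hL : WL.Admissible E) (hR : WR.Admissible E)
    (hτL : 0 < BaerNunziato.tauSharpL E a WL WR 0)
    (hτR : 0 < BaerNunziato.tauSharpR E a WL WR 0)
    (hA : BaerNunziato.ConditionA E a WL WR) :
    (∃ (u₂ π₁ Q : ℝ) (v : ℝ → BaerNunziato.PhaseState),
      BaerNunziato.IsPhaseOneSolution E a WL WR v u₂ π₁ Q) ∧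
    ∀ (u₂ π₁ Q : ℝ) (v : ℝ → BaerNunziato.PhaseState),
      BaerNunziato.IsPhaseOneSolution E a WL WR v u₂ π₁ Q →
      BaerNunziato.ConditionB E a WL WR u₂ →
      ∃ W : ℝ → BaerNunziato.State,
        BaerNunziato.IsSubsonicSolution E a WL WR W u₂ π₁ Q ∧ ∀ ξ, (W ξ).phase 0 = v ξ :=
  ⟨BaerNunziato.exists_isPhaseOneSolution ha hL hR hτL hτR hA,
    fun _ _ _ _ h hB => h.exists_isSubsonicSolution (ha 1) hL hR hB⟩

theorem mainTheorem3 (E : Fin 2 → BaerNunziato.EOS) (a : Fin 2 → ℝ)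
    (WL WR : BaerNunziato.State)
    (ha : ∀ k, 0 < a k)
    (hL : WL.Admissible E) (hR : WR.Admissible E)
    (hτL : ∀ k, 0 < BaerNunziato.tauSharpL E a WL WR k)
    (hτR : ∀ k, 0 < BaerNunziato.tauSharpR E a WL WR k)
    (hA : BaerNunziato.ConditionA E a WL WR) :
    (∃ (u₂ π₁ Q : ℝ) (v : ℝ → BaerNunziato.PhaseState),
      BaerNunziato.IsPhaseOneSolution E a WL WR v u₂ π₁ Q) ∧
    ∀ (u₂ π₁ Q : ℝ) (v : ℝ → BaerNunziato.PhaseState),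
      BaerNunziato.IsPhaseOneSolution E a WL WR v u₂ π₁ Q →
      BaerNunziato.ConditionB E a WL WR u₂ →
      ∃ W : ℝ → BaerNunziato.State,
        BaerNunziato.IsSubsonicSolution E a WL WR W u₂ π₁ Q ∧ ∀ ξ, (W ξ).phase 0 = v ξ :=
  mainTheorem3_general E a WL WR ha hL hR (hτL 0) (hτR 0) hA
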